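/- Let $G$ be a Lie group with Lie algebra $\mathfrak g$, acting smoothly on the left on a finite-dimensional smooth manifold $Q$ in such a way that the quotient map $\pi:Q\to Q/G$ is a principal $G$-bundle. For $\xi\in\mathfrak g$ let $\xi_Q(q)=\frac{d}{dt}\big|_{t=0}\exp(t\xi)\cdot q$. Let $\mathcal A_d:Q\times Q\to G$ be an affine discrete connection of level $\gamma$: $\gamma:Q\to G$ is smooth with $\gamma(gq)=g\gamma(q)g^{-1}$, and $\mathcal A_d$ is smooth with $\mathcal A_d(g_0q_0,g_1q_1)=g_1\mathcal A_d(q_0,q_1)g_0^{-1}$ and $\mathcal A_d(q,\gamma(q)q)=e$. Let $\mathfrak A:TQ\to\mathfrak g$ be a principal connection on $\pi$, with horizontal lift $h^q:T_{\pi(q)}(Q/G)\to T_qQ$. Let $L_d:Q\times Q\to\mathbb R$ be a smooth function and $f_d$ a smooth $1$-form on $Q\times Q$, both invariant under the diagonal action of $G$. Write $f_d(q_0,q_1)(\delta q_0,\delta q_1)=f_d^-(q_0,q_1)(\delta q_0)+f_d^+(q_0,q_1)(\delta q_1)$. Write $D_i$ for the partial differential in the $i$-th factor of a product. Let $\tilde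 G=(Q\times G)/G$ be the quotient by $g\cdot(q,w)=(gq,gwg^{-1})$, with projection $\rho:Q\times G\to\tilde G$, and put $\Upsilon(q_0,q_1)=(\rho(q_0,\mathcal A_d(q_0,q_1)),\pi(q_1))\in\tilde G\times Q/G$. Let $\tilde\Psi:Q\times G\times Q/G\to Q\times Q$ be the inverse of $(q_0,q_1)\mapsto(q_0,\mathcal A_d(q_0,q_1),\pi(q_1))$. Put $\check L_d=L_d\circ\tilde\Psi$ and $\check f_d=\tilde\Psi^*f_d$, and let $\check f_d^1,\check f_d^2,\check f_d^3$ be the components of $\check f_d$ along $Q$, $G$ and $Q/G$. Let $\hat L_d:\tilde G\times Q/G\to\mathbb R$ be the function with $\hat L_d\circ\Upsilon=L_d$. Let $[(q_0,q_1),\xi]$ denote a class in $(Q\times Q\times\mathfrak g)/G$, where $G$ acts diagonally on $Q\times Q$ and by the adjoint action on $\mathfrak g$. The reduced force $\hat f_d$ is defined by $$\hat f_d(\Upsilon(q_0,q_1))\big((\delta v,\delta\tau)\oplus[(q_0,q_1),\xi]\big)=f_d(q_0,q_1)(\delta q_0,\delta q_1),$$ where $(\delta q_0,\delta q_1)$ is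 the tangent vector at $(q_0,q_1)$ with $T\Upsilon(\delta q_0,\delta q_1)=(\delta v,\delta\tau)$ and $\frac12(\mathfrak A(\delta q_0)+\mathfrak A(\delta q_1))=\xi$. Let $q_\cdot=(q_0,\dots,q_N)$ be a discrete curve in $Q$, and put $\tau_k=\pi(q_k)$ for $0\le k\le N$, and $w_k=\mathcal A_d(q_k,q_{k+1})$, $v_k=\rho(q_k,w_k)$ for $0\le k\le N-1$. Then the following are equivalent. 1. For all $\delta q_k\in T_{q_k}Q$ $(0\le k\le N)$ with $\delta q_0=0$ and $\delta q_N=0$, $$\delta\Big(\sum_{k=0}^{N-1}L_d(q_k,q_{k+1})\Big)+\sum_{k=0}^{N-1}f_d(q_k,q_{k+1})(\delta q_k,\delta q_{k+1})=0.$$ 2. For $1\le k\le N-1$, $$D_2L_d(q_{k-1},q_k)+D_1L_d(q_k,q_{k+1})+f_d^+(q_{k-1},q_k)+f_d^-(q_k,q_{k+1})=0\in T^*_{q_k}Q.$$ 3. One has $$\delta\Big(\sum_{k=0}^{N-1}\hat L_d(v_k,\tau_{k+1})\Big)+\sum_{k=0}^{N-1}\hat f_d(v_k,\tau_{k+1})\Big((\delta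 v_k,\delta\tau_{k+1})\oplus\big[(q_k,q_{k+1}),\tfrac12(\xi_k+\xi_{k+1})\big]\Big)=0$$ for all $\delta\tau_k\in T_{\tau_k}(Q/G)$ and $\xi_k\in\mathfrak g$ $(0\le k\le N)$ with $\delta\tau_0=0$, $\delta\tau_N=0$, $\xi_0=\xi_N=0$, where for $0\le k\le N-1$ $$\begin{aligned}\delta v_k&=T_{(q_k,w_k)}\rho\big(h^{q_k}(\delta\tau_k),\,T_{(q_k,q_{k+1})}\mathcal A_d(h^{q_k}(\delta\tau_k),h^{q_{k+1}}(\delta\tau_{k+1}))\big)\\&\quad+T_{(q_k,w_k)}\rho\big((\xi_k)_Q(q_k),\,T_{(q_k,q_{k+1})}\mathcal A_d((\xi_k)_Q(q_k),(\xi_{k+1})_Q(q_{k+1}))\big).\end{aligned}$$ 4. For $1\le k\le N-1$ one has $\phi_{f_d}=0$ in $T^*_{\tau_k}(Q/G)$ and $\psi_{f_d}(\xi)=0$ for all $\xi\in\mathfrak g$, where, with $x_k=(q_k,w_k,\tau_{k+1})$, $$\begin{aligned}\phi_{f_d}&=D_1\check L_d(x_k)\circ h^{q_k}+D_3\check L_d(x_{k-1})+D_2\check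 L_d(x_k)\,D_1\mathcal A_d(q_k,q_{k+1})\circ h^{q_k}+D_2\check L_d(x_{k-1})\,D_2\mathcal A_d(q_{k-1},q_k)\circ h^{q_k}\\&\quad+\check f_d^1(x_k)\circ h^{q_k}+\check f_d^3(x_{k-1})+\check f_d^2(x_k)\,D_1\mathcal A_d(q_k,q_{k+1})\circ h^{q_k}+\check f_d^2(x_{k-1})\,D_2\mathcal A_d(q_{k-1},q_k)\circ h^{q_k},\\ \psi_{f_d}(\xi)&=\big(D_2\check L_d(x_{k-1})w_{k-1}^{-1}-D_2\check L_d(x_k)w_k^{-1}\big)(\xi)\\&\quad+\big(\check f_d^1(x_k)+\check f_d^2(x_k)\,D_1\mathcal A_d(q_k,q_{k+1})+\check f_d^2(x_{k-1})\,D_2\mathcal A_d(q_{k-1},q_k)\big)(\xi_Q(q_k)),\end{aligned}$$ and for $w\in G$ and $\alpha\in T_w^*G$ the covector $\alpha w^{-1}\in\mathfrak g^*$ is $\xi\mapsto\alpha(T_eR_w\xi)$, with $R_w$ the right translation by $w$. -/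

import Mathlib

open Set
open scoped Manifold ContDiff Topology

noncomputable section

namespace ForcedReduction

/-! ### Tangent vectors, differentials and one-forms -/

section Tangent

variable {E F : Type*} [NormedAddCommGroup E] [NormedSpace ℝ E]
  [NormedAddCommGroup F] [NormedSpace ℝ F]
  {H K : Type*} [TopologicalSpace H] [TopologicalSpace K]
  {I : ModelWithCorners ℝ E H} {J : ModelWithCorners ℝ F K}
  {M N : Type*} [TopologicalSpace M] [ChartedSpace H M] [TopologicalSpace N] [ChartedSpace K N]

/-- The identification of the tangent spaces at two equal points. -/
def castT {x y : M} (h : x = y) : TangentSpace I x →L[ℝ] TangentSpace I y :=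
  h ▸ ContinuousLinearMap.id ℝ (TangentSpace I x)

/-- The tangent vector `(u, v)` of a product manifold. -/
def pairT {x : M} {y : N} (u : TangentSpace I x) (v : TangentSpace J y) :
    TangentSpace (I.prod J) (x, y) :=
  ((u, v) : E × F)

/-- The inclusion `u ↦ (u, 0)` of the tangent space of the first factor. -/
def inlT (x : M) (y : N) : TangentSpace I x →L[ℝ] TangentSpace (I.prod J) (x, y) :=
  ContinuousLinearMap.inl ℝ E F

/-- The inclusion `v ↦ (0, v)` of the tangent space of the second factor. -/
def inrT (x : M) (y : N) : TangentSpace J y →L[ℝ] TangentSpace (I.prod J) (x, y) :=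
  ContinuousLinearMap.inr ℝ E F

/-- The first component of a tangent vector of a product manifold. -/
def fstT (x : M) (y : N) : TangentSpace (I.prod J) (x, y) →L[ℝ] TangentSpace I x :=
  ContinuousLinearMap.fst ℝ E F

/-- The second component of a tangent vector of a product manifold. -/
def sndT (x : M) (y : N) : TangentSpace (I.prod J) (x, y) →L[ℝ] TangentSpace J y :=
  ContinuousLinearMap.snd ℝ E F

/-- The tangent vector of a finite power of a manifold with given components. -/
def familyT {n : ℕ} {x : Fin n → M} (u : ∀ k, TangentSpace I (x k)) :
    TangentSpace (ModelWithCorners.pi fun _ : Fin n => I) x :=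
  (u : Fin n → E)

/-- The differential of a real function, as a covector. -/
def differential (I : ModelWithCorners ℝ E H) (f : M → ℝ) (x : M) : TangentSpace I x →L[ℝ] ℝ :=
  mfderiv I 𝓘(ℝ, ℝ) f x

/-- A smooth one-form, seen as a smooth function on the tangent bundle that is linear on fibers. -/
structure OneForm (I : ModelWithCorners ℝ E H) (M : Type*) [TopologicalSpace M]
    [ChartedSpace H M] [IsManifold I 1 M] where
  toFun : ∀ x : M, TangentSpace I x →L[ℝ] ℝ
  contMDiff_toFun : ContMDiff I.tangent 𝓘(ℝ, ℝ) ∞ fun v : TangentBundle I M => toFun v.1 v.2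

end Tangent

/-! ### Orbit spaces and principal bundles -/

/-- The quotient `Q/G`. -/
abbrev OrbitSpace (G Q : Type*) [Group G] [MulAction G Q] : Type _ :=
  MulAction.orbitRel.Quotient G Q

/-- The quotient map `π : Q → Q/G`. -/
def orbitProj (G : Type*) {Q : Type*} [Group G] [MulAction G Q] (q : Q) : OrbitSpace G Q :=
  Quotient.mk _ q

theorem orbitProj_smul {G Q : Type*} [Group G] [MulAction G Q] (g : G) (q : Q) :
    orbitProj G (g • q) = orbitProj G q :=
  MulAction.orbitRel.Quotient.quotient_smul_eq

theorem exists_smul_of_orbitProj_eq {G Q : Type*} [Group G] [MulAction G Q] {q q' : Q}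
    (h : orbitProj G q = orbitProj G q') : ∃ g : G, g • q = q' := by
  have h' := Quotient.exact h.symm
  exact h'

section PrincipalBundle

variable (EQ EB EG G Q : Type*)
  [NormedAddCommGroup EQ] [NormedSpace ℝ EQ] [NormedAddCommGroup EB] [NormedSpace ℝ EB]
  [NormedAddCommGroup EG] [NormedSpace ℝ EG]
  [TopologicalSpace G] [ChartedSpace EG G] [Group G]
  [TopologicalSpace Q] [ChartedSpace EQ Q] [MulAction G Q]
  [ChartedSpace EB (OrbitSpace G Q)]

/-- A `G`-equivariant local trivialization `π⁻¹(U) ≅ U × G` of `π : Q → Q/G`: a diffeomorphism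
over `U`, where `G` acts on `U × G` by left translations of the second factor. -/
structure LocalTriv extends OpenPartialHomeomorph Q (OrbitSpace G Q × G) where
  baseSet : Set (OrbitSpace G Q)
  open_baseSet : IsOpen baseSet
  source_eq : source = orbitProj G ⁻¹' baseSet
  target_eq : target = baseSet ×ˢ univ
  fst_apply : ∀ q ∈ source, (toFun q).1 = orbitProj G q
  snd_smul : ∀ g : G, ∀ q ∈ source, (toFun (g • q)).2 = g * (toFun q).2
  contMDiffOn_toFun : ContMDiffOn 𝓘(ℝ, EQ) (𝓘(ℝ, EB).prod 𝓘(ℝ, EG)) ∞ toFun source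
  contMDiffOn_invFun : ContMDiffOn (𝓘(ℝ, EB).prod 𝓘(ℝ, EG)) 𝓘(ℝ, EQ) ∞ invFun target

/-- The left action of `G` on `Q` is smooth and `π : Q → Q/G` is a principal `G`-bundle. -/
class IsPrincipalBundle : Prop where
  contMDiffSMul : ContMDiffSMul 𝓘(ℝ, EG) 𝓘(ℝ, EQ) ∞ G Q
  exists_localTriv : ∀ b : OrbitSpace G Q, ∃ t : LocalTriv EQ EB EG G Q, b ∈ t.baseSet

end PrincipalBundle

/-! ### The conjugate bundle -/

/-- The orbit relation of the action `g • (q, w) = (g • q, g w g⁻¹)` on `Q × G`. -/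
def conjSetoid (G Q : Type*) [Group G] [MulAction G Q] : Setoid (Q × G) where
  r p p' := ∃ g : G, g • p.1 = p'.1 ∧ g * p.2 * g⁻¹ = p'.2
  iseqv :=
    { refl := fun p => ⟨1, by simp⟩
      symm := by
        rintro p p' ⟨g, h1, h2⟩
        exact ⟨g⁻¹, by simp [← h1], by simp [← h2, mul_assoc]⟩
      trans := by
        rintro p p' p'' ⟨g, h1, h2⟩ ⟨k, h3, h4⟩
        exact ⟨k * g, by rw [mul_smul, h1, h3], by rw [← h4, ← h2]; group⟩ }

/-- The conjugate bundle `(Q × G)/G`. The model spaces are arguments of the type only so that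
its smooth structure can be found by instance search. -/
def ConjBundle (_EQ _EB _EG G Q : Type*) [Group G] [MulAction G Q] : Type _ :=
  Quotient (conjSetoid G Q)

instance conjBundleTopology (EQ EB EG G Q : Type*) [Group G] [MulAction G Q] [TopologicalSpace G]
    [TopologicalSpace Q] : TopologicalSpace (ConjBundle EQ EB EG G Q) :=
  inferInstanceAs (TopologicalSpace (Quotient (conjSetoid G Q)))

/-- The quotient map `ρ : Q × G → (Q × G)/G`. -/
def conjMk (EQ EB EG : Type*) {G Q : Type*} [Group G] [MulAction G Q] (p : Q × G) :
    ConjBundle EQ EB EG G Q :=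
  Quotient.mk (conjSetoid G Q) p

theorem conjMk_smul (EQ EB EG : Type*) {G Q : Type*} [Group G] [MulAction G Q]
    (g : G) (q : Q) (w : G) :
    conjMk EQ EB EG (g • q, g * w * g⁻¹) = conjMk EQ EB EG (q, w) :=
  (Quotient.sound (s := conjSetoid G Q) ⟨g, rfl, rfl⟩).symm

theorem exists_smul_eq_out (EQ EB EG : Type*) {G Q : Type*} [Group G] [MulAction G Q]
    (q : Q) (w : G) : ∃ g : G,
    Quotient.out (s := conjSetoid G Q) (conjMk EQ EB EG (q, w)) = (g • q, g * w * g⁻¹) := by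
  obtain ⟨g, h1, h2⟩ := Quotient.exact
    (Quotient.out_eq (s := conjSetoid G Q) (conjMk EQ EB EG (q, w))).symm
  exact ⟨g, Prod.ext h1.symm h2.symm⟩

section ConjBundle

variable {EQ EB EG G Q : Type*}
  [NormedAddCommGroup EQ] [NormedSpace ℝ EQ] [NormedAddCommGroup EB] [NormedSpace ℝ EB]
  [NormedAddCommGroup EG] [NormedSpace ℝ EG]
  [TopologicalSpace G] [ChartedSpace EG G] [Group G]
  [TopologicalSpace Q] [ChartedSpace EQ Q] [MulAction G Q]
  [ChartedSpace EB (OrbitSpace G Q)]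

/-- In a local trivialization `q ↦ (π q, c q)`, the map `(q, w) ↦ (π q, (c q)⁻¹ w (c q))`. It is
invariant under the action of `G`. -/
def LocalTriv.conjFun (t : LocalTriv EQ EB EG G Q) (p : Q × G) : OrbitSpace G Q × G :=
  (orbitProj G p.1, (t.toFun p.1).2⁻¹ * p.2 * (t.toFun p.1).2)

theorem LocalTriv.mem_source_iff (t : LocalTriv EQ EB EG G Q) (q : Q) :
    q ∈ t.source ↔ orbitProj G q ∈ t.baseSet := by rw [t.source_eq]; rfl

theorem LocalTriv.conjFun_out (t : LocalTriv EQ EB EG G Q) {q : Q} (hq : q ∈ t.source) (w : G) :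
    t.conjFun (Quotient.out (s := conjSetoid G Q) (conjMk EQ EB EG (q, w))) =
      t.conjFun (q, w) := by
  obtain ⟨g, hg⟩ := exists_smul_eq_out EQ EB EG q w
  rw [hg]
  simp only [LocalTriv.conjFun, orbitProj_smul, t.snd_smul g q hq]
  refine Prod.ext rfl ?_
  simp only
  group

theorem LocalTriv.symm_mem (t : LocalTriv EQ EB EG G Q) {b : OrbitSpace G Q} (hb : b ∈ t.baseSet)
    (g : G) : t.invFun (b, g) ∈ t.source ∧ orbitProj G (t.invFun (b, g)) = b ∧
      t.toFun (t.invFun (b, g)) = (b, g) := by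
  have ht : (b, g) ∈ t.target := by rw [t.target_eq]; exact ⟨hb, trivial⟩
  have h1 := t.map_target' ht
  have h2 := t.right_inv' ht
  refine ⟨h1, ?_, h2⟩
  rw [← t.fst_apply _ h1, h2]

theorem LocalTriv.preimage_conj_source (t : LocalTriv EQ EB EG G Q) :
    conjMk EQ EB EG ⁻¹' (conjMk EQ EB EG '' (t.source ×ˢ (univ : Set G))) = t.source ×ˢ univ := by
  apply Subset.antisymm
  · rintro ⟨q, w⟩ ⟨⟨q', w'⟩, ⟨h, -⟩, h'⟩
    obtain ⟨g, h1, -⟩ := Quotient.exact h'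
    refine ⟨?_, trivial⟩
    rw [t.mem_source_iff] at h ⊢
    have h1 : g • q' = q := h1
    rwa [← h1, orbitProj_smul]
  · exact subset_preimage_image _ _

theorem LocalTriv.isOpen_conj_source (t : LocalTriv EQ EB EG G Q) :
    IsOpen (conjMk EQ EB EG '' (t.source ×ˢ (univ : Set G))) := by
  have hq : Topology.IsQuotientMap (conjMk EQ EB EG : Q × G → ConjBundle EQ EB EG G Q) :=
    isQuotientMap_quotient_mk'
  rw [← hq.isOpen_preimage, t.preimage_conj_source]
  exact t.open_source.prod isOpen_univ

variable [LieGroup 𝓘(ℝ, EG) ∞ G]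

/-- The homeomorphism `(π⁻¹(U) × G)/G ≅ U × G` induced by a local trivialization over `U`. -/
def LocalTriv.conjChart (t : LocalTriv EQ EB EG G Q) :
    OpenPartialHomeomorph (ConjBundle EQ EB EG G Q) (OrbitSpace G Q × G) where
  toFun v := t.conjFun (Quotient.out (s := conjSetoid G Q) v)
  invFun p := conjMk EQ EB EG (t.invFun (p.1, 1), p.2)
  source := conjMk EQ EB EG '' (t.source ×ˢ univ)
  target := t.baseSet ×ˢ univ
  map_source' := by
    rintro _ ⟨⟨q, w⟩, ⟨hq, -⟩, rfl⟩
    rw [t.conjFun_out hq]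
    exact ⟨(t.mem_source_iff q).1 hq, trivial⟩
  map_target' := by
    rintro ⟨b, w⟩ ⟨hb, -⟩
    exact ⟨_, ⟨(t.symm_mem hb 1).1, trivial⟩, rfl⟩
  left_inv' := by
    rintro _ ⟨⟨q, w⟩, ⟨hq, -⟩, rfl⟩
    rw [t.conjFun_out hq]
    have hb := (t.mem_source_iff q).1 hq
    obtain ⟨h1, h2, h3⟩ := t.symm_mem hb 1
    obtain ⟨g, hg⟩ := exists_smul_of_orbitProj_eq h2
    have h4 := t.snd_smul g _ h1
    rw [hg, h3] at h4
    simp only [LocalTriv.conjFun]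
    rw [← conjMk_smul EQ EB EG g, hg, h4]
    congr 2
    group
  right_inv' := by
    rintro ⟨b, w⟩ ⟨hb, -⟩
    obtain ⟨h1, h2, h3⟩ := t.symm_mem hb 1
    rw [t.conjFun_out h1]
    unfold LocalTriv.conjFun
    simp only at h2 h3 ⊢
    rw [h2, h3]
    simp
  open_source := t.isOpen_conj_source
  open_target := t.open_baseSet.prod isOpen_univ
  continuousOn_toFun := by
    have : IsTopologicalGroup G := topologicalGroup_of_lieGroup 𝓘(ℝ, EG) ∞
    have hq : Topology.IsQuotientMap (conjMk EQ EB EG : Q × G → ConjBundle EQ EB EG G Q) :=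
      isQuotientMap_quotient_mk'
    rw [hq.continuousOn_isOpen_iff t.isOpen_conj_source, t.preimage_conj_source]
    have hc : ContinuousOn (fun p : Q × G => (t.toFun p.1).2) (t.source ×ˢ univ) :=
      (continuous_snd.comp_continuousOn t.continuousOn_toFun).comp continuousOn_fst
        fun p hp => hp.1
    have h : ContinuousOn t.conjFun (t.source ×ˢ univ) := by
      refine ContinuousOn.prodMk ?_ ((hc.inv.mul continuousOn_snd).mul hc)
      exact (continuous_quotient_mk'.comp continuous_fst).continuousOn
    exact h.congr fun p hp => t.conjFun_out hp.1 p.2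
  continuousOn_invFun := by
    have hm : Continuous (conjMk EQ EB EG : Q × G → ConjBundle EQ EB EG G Q) :=
      continuous_quotient_mk'
    refine hm.comp_continuousOn (ContinuousOn.prodMk ?_ continuousOn_snd)
    refine t.continuousOn_invFun.comp (by fun_prop) ?_
    rintro ⟨b, w⟩ ⟨hb, -⟩
    rw [t.target_eq]
    exact ⟨hb, trivial⟩

theorem contMDiffOn_conj_transition (t t' : LocalTriv EQ EB EG G Q) :
    ContMDiffOn (𝓘(ℝ, EB).prod 𝓘(ℝ, EG)) (𝓘(ℝ, EB).prod 𝓘(ℝ, EG)) ∞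
      (t.conjChart.symm.trans t'.conjChart) (t.conjChart.symm.trans t'.conjChart).source := by
  have key : ∀ p ∈ (t.conjChart.symm.trans t'.conjChart).source,
      p.1 ∈ t.baseSet ∧ t.invFun (p.1, 1) ∈ t'.source := by
    rintro ⟨b, w⟩ ⟨⟨hb, -⟩, h⟩
    have h' : (t.invFun (b, 1), w) ∈ conjMk EQ EB EG ⁻¹'
        (conjMk EQ EB EG '' (t'.source ×ˢ (univ : Set G))) := h
    rw [t'.preimage_conj_source] at h'
    exact ⟨hb, h'.1⟩
  set S := (t.conjChart.symm.trans t'.conjChart).source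
  have hs : ContMDiffOn (𝓘(ℝ, EB).prod 𝓘(ℝ, EG)) 𝓘(ℝ, EQ) ∞
      (fun p : OrbitSpace G Q × G => t.invFun (p.1, 1)) S := by
    refine t.contMDiffOn_invFun.comp (contMDiffOn_fst.prodMk contMDiffOn_const) ?_
    intro p hp
    change (p.1, (1 : G)) ∈ t.target
    rw [t.target_eq]
    exact ⟨(key p hp).1, trivial⟩
  have hc : ContMDiffOn (𝓘(ℝ, EB).prod 𝓘(ℝ, EG)) 𝓘(ℝ, EG) ∞
      (fun p : OrbitSpace G Q × G => (t'.toFun (t.invFun (p.1, 1))).2) S :=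
    contMDiff_snd.comp_contMDiffOn
      (t'.contMDiffOn_toFun.comp hs fun p hp => (key p hp).2)
  have hf : ContMDiffOn (𝓘(ℝ, EB).prod 𝓘(ℝ, EG)) (𝓘(ℝ, EB).prod 𝓘(ℝ, EG)) ∞
      (fun p : OrbitSpace G Q × G => (p.1, (t'.toFun (t.invFun (p.1, 1))).2⁻¹ * p.2 *
        (t'.toFun (t.invFun (p.1, 1))).2)) S :=
    contMDiffOn_fst.prodMk ((hc.inv.mul contMDiffOn_snd).mul hc)
  refine hf.congr ?_
  intro p hp
  have h1 := t'.conjFun_out (key p hp).2 p.2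
  change t'.conjFun _ = _
  refine h1.trans ?_
  unfold LocalTriv.conjFun
  simp only
  rw [(t.symm_mem (key p hp).1 1).2.1]

variable [IsPrincipalBundle EQ EB EG G Q]

variable (EQ EB EG) in
/-- A local trivialization around a given orbit. -/
def localTrivAt (b : OrbitSpace G Q) : LocalTriv EQ EB EG G Q :=
  (IsPrincipalBundle.exists_localTriv b).choose

/-- The conjugate bundle is locally `U × G` with `U` open in `Q/G`. -/
@[reducible]
def conjBundleChartedProd : ChartedSpace (OrbitSpace G Q × G) (ConjBundle EQ EB EG G Q) where
  atlas := range fun b => (localTrivAt EQ EB EG b : LocalTriv EQ EB EG G Q).conjChart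
  chartAt v := (localTrivAt EQ EB EG
    (orbitProj G (Quotient.out (s := conjSetoid G Q) v).1)).conjChart
  mem_chart_source v := by
    refine ⟨Quotient.out (s := conjSetoid G Q) v, ⟨?_, trivial⟩, Quotient.out_eq _⟩
    rw [LocalTriv.mem_source_iff]
    exact (IsPrincipalBundle.exists_localTriv (EQ := EQ) (EB := EB) (EG := EG) (G := G) (Q := Q)
      _).choose_spec
  chart_mem_atlas v := mem_range_self _

/-- The smooth structure of the conjugate bundle. -/
instance conjBundleCharted : ChartedSpace (ModelProd EB EG) (ConjBundle EQ EB EG G Q) :=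
  letI := conjBundleChartedProd (EQ := EQ) (EB := EB) (EG := EG) (G := G) (Q := Q)
  ChartedSpace.comp (ModelProd EB EG) (OrbitSpace G Q × G) (ConjBundle EQ EB EG G Q)

variable [IsManifold 𝓘(ℝ, EB) ∞ (OrbitSpace G Q)]

instance conjBundleManifold :
    IsManifold (𝓘(ℝ, EB).prod 𝓘(ℝ, EG)) ∞ (ConjBundle EQ EB EG G Q) := by
  refine isManifold_of_contDiffOn _ _ _ ?_
  rintro _ _ ⟨_, ⟨b, rfl⟩, f, hf, rfl⟩ ⟨_, ⟨b', rfl⟩, f', hf', rfl⟩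
  have h1 := contMDiffOn_symm_of_mem_maximalAtlas (I := 𝓘(ℝ, EB).prod 𝓘(ℝ, EG)) (n := ∞)
    (IsManifold.subset_maximalAtlas hf)
  have h2 := contMDiffOn_of_mem_maximalAtlas (I := 𝓘(ℝ, EB).prod 𝓘(ℝ, EG)) (n := ∞)
    (IsManifold.subset_maximalAtlas hf')
  have h3 := contMDiffOn_conj_transition (localTrivAt EQ EB EG b : LocalTriv EQ EB EG G Q)
    (localTrivAt EQ EB EG b')
  rw [← contMDiffOn_iff_contDiffOn]
  have h4 := (𝓘(ℝ, EB).prod 𝓘(ℝ, EG)).contMDiff (n := ∞)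
  have h5 := (𝓘(ℝ, EB).prod 𝓘(ℝ, EG)).contMDiffOn_symm (n := ∞)
  have h6 := h2.comp (h3.comp (h1.comp (h5.mono inter_subset_right) (t := f.target) (s :=
    (𝓘(ℝ, EB).prod 𝓘(ℝ, EG)).symm ⁻¹' ((((localTrivAt EQ EB EG b :
      LocalTriv EQ EB EG G Q).conjChart.trans f).symm.trans
      ((localTrivAt EQ EB EG b').conjChart.trans f')).source) ∩ range _) ?_) ?_) ?_
  · exact h4.comp_contMDiffOn h6
  · rintro x ⟨hx, -⟩
    simp only [mfld_simps] at hx ⊢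
    exact hx.1.1
  · rintro x ⟨hx, -⟩
    simp only [mfld_simps] at hx ⊢
    exact ⟨hx.1.2, hx.2.1⟩
  · rintro x ⟨hx, -⟩
    simp only [mfld_simps] at hx ⊢
    exact hx.2.2

end ConjBundle

/-! ### Forced discrete mechanical systems -/

section Systems

variable (EQ Q : Type*) [NormedAddCommGroup EQ] [NormedSpace ℝ EQ]
  [TopologicalSpace Q] [ChartedSpace EQ Q] [IsManifold 𝓘(ℝ, EQ) ∞ Q]

/-- A forced discrete mechanical system on `Q`: a smooth discrete Lagrangian and a smooth one-form
on `Q × Q`, the discrete force. -/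
structure FDMS where
  lagrangian : Q × Q → ℝ
  contMDiff_lagrangian : ContMDiff (𝓘(ℝ, EQ).prod 𝓘(ℝ, EQ)) 𝓘(ℝ, ℝ) ∞ lagrangian
  force : OneForm (𝓘(ℝ, EQ).prod 𝓘(ℝ, EQ)) (Q × Q)

variable {EQ Q}

/-- `D₁ L_d (q₀, q₁)`, a covector at `q₀`. -/
def FDMS.D₁L (S : FDMS EQ Q) (q₀ q₁ : Q) : TangentSpace 𝓘(ℝ, EQ) q₀ →L[ℝ] ℝ :=
  (differential (𝓘(ℝ, EQ).prod 𝓘(ℝ, EQ)) S.lagrangian (q₀, q₁)).comp (inlT q₀ q₁)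

/-- `D₂ L_d (q₀, q₁)`, a covector at `q₁`. -/
def FDMS.D₂L (S : FDMS EQ Q) (q₀ q₁ : Q) : TangentSpace 𝓘(ℝ, EQ) q₁ →L[ℝ] ℝ :=
  (differential (𝓘(ℝ, EQ).prod 𝓘(ℝ, EQ)) S.lagrangian (q₀, q₁)).comp (inrT q₀ q₁)

/-- The component `f_d⁻ (q₀, q₁)` of the force, a covector at `q₀`. -/
def FDMS.forceMinus (S : FDMS EQ Q) (q₀ q₁ : Q) : TangentSpace 𝓘(ℝ, EQ) q₀ →L[ℝ] ℝ :=
  (S.force.toFun (q₀, q₁)).comp (inlT q₀ q₁)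

/-- The component `f_d⁺ (q₀, q₁)` of the force, a covector at `q₁`. -/
def FDMS.forcePlus (S : FDMS EQ Q) (q₀ q₁ : Q) : TangentSpace 𝓘(ℝ, EQ) q₁ →L[ℝ] ℝ :=
  (S.force.toFun (q₀, q₁)).comp (inrT q₀ q₁)

/-- The discrete action functional on discrete curves `q₀, …, q_N`. -/
def FDMS.action (S : FDMS EQ Q) {N : ℕ} (q : Fin (N + 1) → Q) : ℝ :=
  ∑ k : Fin N, S.lagrangian (q k.castSucc, q k.succ)

/-- The forced variational principle: `q` is a trajectory of the system. The variation of the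
action is its differential as a function on the product manifold `Q ^ (N + 1)`. -/
def FDMS.IsTrajectory (S : FDMS EQ Q) {N : ℕ} (q : Fin (N + 1) → Q) : Prop :=
  ∀ δq : ∀ k, TangentSpace 𝓘(ℝ, EQ) (q k), δq 0 = 0 → δq (Fin.last N) = 0 →
    differential (ModelWithCorners.pi fun _ : Fin (N + 1) => 𝓘(ℝ, EQ)) S.action q (familyT δq) +
      ∑ k : Fin N, S.force.toFun (q k.castSucc, q k.succ)
        (pairT (δq k.castSucc) (δq k.succ)) = 0

/-- The covector `D₂ L_d (a, b) + D₁ L_d (b, c) + f_d⁺ (a, b) + f_d⁻ (b, c)` at `b`. -/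
def FDMS.eulerLagrange (S : FDMS EQ Q) (a b c : Q) : TangentSpace 𝓘(ℝ, EQ) b →L[ℝ] ℝ :=
  S.D₂L a b + S.D₁L b c + S.forcePlus a b + S.forceMinus b c

/-- The forced discrete Euler-Lagrange equations at `q₁, …, q_{N-1}`. -/
def FDMS.ForcedEulerLagrange (S : FDMS EQ Q) {N : ℕ} (q : Fin (N + 1) → Q) : Prop :=
  ∀ (k : ℕ) (_ : 1 ≤ k) (_ : k < N),
    S.eulerLagrange (q ⟨k - 1, by omega⟩) (q ⟨k, by omega⟩) (q ⟨k + 1, by omega⟩) = 0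

/-- `G` is a symmetry group: `L_d` and `f_d` are invariant under the diagonal action. -/
structure FDMS.IsSymmetric (S : FDMS EQ Q) (G : Type*) [Group G] [MulAction G Q] : Prop where
  lagrangian_smul : ∀ (g : G) (p : Q × Q), S.lagrangian (g • p) = S.lagrangian p
  force_smul : ∀ (g : G) (p : Q × Q) (v : TangentSpace (𝓘(ℝ, EQ).prod 𝓘(ℝ, EQ)) p),
    S.force.toFun (g • p) (mfderiv (𝓘(ℝ, EQ).prod 𝓘(ℝ, EQ)) (𝓘(ℝ, EQ).prod 𝓘(ℝ, EQ))
      (fun x : Q × Q => g • x) p v) = S.force.toFun p v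

end Systems

/-! ### Lie group actions and connections -/

section LieGroups

variable {EG G : Type*} [NormedAddCommGroup EG] [NormedSpace ℝ EG]
  [TopologicalSpace G] [ChartedSpace EG G] [Group G]

/-- The adjoint action of `g`, i.e. the derivative at `1` of the conjugation by `g`. -/
def adjointMap (g : G) : GroupLieAlgebra 𝓘(ℝ, EG) G →L[ℝ] GroupLieAlgebra 𝓘(ℝ, EG) G :=
  (castT (show g * 1 * g⁻¹ = (1 : G) by simp)).comp
    (mfderiv 𝓘(ℝ, EG) 𝓘(ℝ, EG) (fun h : G => g * h * g⁻¹) 1)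

/-- The derivative at `1` of the right translation by `w`. -/
def rightTranslation (w : G) : GroupLieAlgebra 𝓘(ℝ, EG) G →L[ℝ] TangentSpace 𝓘(ℝ, EG) w :=
  (castT (one_mul w)).comp (mfderiv 𝓘(ℝ, EG) 𝓘(ℝ, EG) (fun h : G => h * w) 1)

/-- The infinitesimal generator `ξ ↦ ξ_Q(q)`, i.e. the derivative at `1` of `g ↦ g • q`: the
derivative at `t = 0` of `c t • q` for any curve `c` in `G` through `1` with velocity `ξ`, such as
`exp (t ξ)`. -/
def infGen {EQ Q : Type*} [NormedAddCommGroup EQ] [NormedSpace ℝ EQ]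
    [TopologicalSpace Q] [ChartedSpace EQ Q] [MulAction G Q] (q : Q) :
    GroupLieAlgebra 𝓘(ℝ, EG) G →L[ℝ] TangentSpace 𝓘(ℝ, EQ) q :=
  (castT (one_smul G q)).comp (mfderiv 𝓘(ℝ, EG) 𝓘(ℝ, EQ) (fun g : G => g • q) 1)

theorem castT_coe {E H M : Type*} [NormedAddCommGroup E] [NormedSpace ℝ E] [TopologicalSpace H]
    {I : ModelWithCorners ℝ E H} [TopologicalSpace M] [ChartedSpace H M] {x y : M} (h : x = y)
    (v : TangentSpace I x) : (castT h v : E) = v := by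
  subst h; rfl

theorem adjointMap_apply (g : G) (ξ : GroupLieAlgebra 𝓘(ℝ, EG) G) :
    (adjointMap g ξ : EG) = mfderiv 𝓘(ℝ, EG) 𝓘(ℝ, EG) (fun h : G => g * h * g⁻¹) 1 ξ :=
  castT_coe (I := 𝓘(ℝ, EG)) (M := G) (show g * 1 * g⁻¹ = (1 : G) by simp) _

theorem adjointMap_one (ξ : GroupLieAlgebra 𝓘(ℝ, EG) G) : adjointMap (1 : G) ξ = ξ := by
  have h : (fun h : G => 1 * h * 1⁻¹) = id := by ext; simp
  refine (adjointMap_apply 1 ξ).trans ?_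
  rw [h, mfderiv_id]
  rfl

theorem adjointMap_mul [LieGroup 𝓘(ℝ, EG) ∞ G] (g k : G) (ξ : GroupLieAlgebra 𝓘(ℝ, EG) G) :
    adjointMap (g * k) ξ = adjointMap g (adjointMap k ξ) := by
  have hd : ∀ g : G, MDifferentiable 𝓘(ℝ, EG) 𝓘(ℝ, EG) fun h : G => g * h * g⁻¹ := fun g =>
    ((contMDiff_const.mul contMDiff_id).mul contMDiff_const :
      ContMDiff 𝓘(ℝ, EG) 𝓘(ℝ, EG) ∞ fun h : G => g * h * g⁻¹).mdifferentiable (by simp)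
  have h : (fun h : G => g * k * h * (g * k)⁻¹) =
      (fun h : G => g * h * g⁻¹) ∘ fun h : G => k * h * k⁻¹ := by
    ext h; simp [mul_assoc]
  have hc : ∀ (y : G) (_ : y = 1) (v : EG),
      (mfderiv 𝓘(ℝ, EG) 𝓘(ℝ, EG) (fun h : G => g * h * g⁻¹) y v : EG) =
        (mfderiv 𝓘(ℝ, EG) 𝓘(ℝ, EG) (fun h : G => g * h * g⁻¹) 1 v : EG) := by
    rintro _ rfl v; rfl
  refine (adjointMap_apply (g * k) ξ).trans (Eq.trans ?_ (adjointMap_apply g _).symm)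
  rw [h, mfderiv_comp (I' := 𝓘(ℝ, EG)) 1 (hd g _) (hd k _)]
  refine (hc (k * 1 * k⁻¹) (by simp) _).trans ?_
  exact congrArg (mfderiv 𝓘(ℝ, EG) 𝓘(ℝ, EG) (fun h : G => g * h * g⁻¹) 1)
    (adjointMap_apply k ξ).symm

end LieGroups

section Connections

variable (EQ EG G Q : Type*)
  [NormedAddCommGroup EQ] [NormedSpace ℝ EQ]
  [NormedAddCommGroup EG] [NormedSpace ℝ EG]
  [TopologicalSpace G] [ChartedSpace EG G] [Group G]
  [TopologicalSpace Q] [ChartedSpace EQ Q] [MulAction G Q]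

/-- An affine discrete connection with its level. -/
structure AffineDiscreteConnection where
  level : Q → G
  contMDiff_level : ContMDiff 𝓘(ℝ, EQ) 𝓘(ℝ, EG) ∞ level
  level_smul : ∀ (g : G) (q : Q), level (g • q) = g * level q * g⁻¹
  conn : Q × Q → G
  contMDiff_conn : ContMDiff (𝓘(ℝ, EQ).prod 𝓘(ℝ, EQ)) 𝓘(ℝ, EG) ∞ conn
  conn_smul : ∀ (g₀ g₁ : G) (q₀ q₁ : Q),
    conn (g₀ • q₀, g₁ • q₁) = g₁ * conn (q₀, q₁) * g₀⁻¹
  conn_level : ∀ q : Q, conn (q, level q • q) = 1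

/-- A principal connection on `π : Q → Q/G`: a smooth equivariant one-form with values in the Lie
algebra of `G` that reproduces the infinitesimal generators. -/
structure PrincipalConnection [IsManifold 𝓘(ℝ, EQ) ∞ Q] where
  form : ∀ q : Q, TangentSpace 𝓘(ℝ, EQ) q →L[ℝ] GroupLieAlgebra 𝓘(ℝ, EG) G
  contMDiff_form : ContMDiff (M' := EG) 𝓘(ℝ, EQ).tangent 𝓘(ℝ, EG) ∞
    fun v : TangentBundle 𝓘(ℝ, EQ) Q => form v.1 v.2
  form_infGen : ∀ (q : Q) (ξ : GroupLieAlgebra 𝓘(ℝ, EG) G), form q (infGen q ξ) = ξ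
  form_smul : ∀ (g : G) (q : Q) (v : TangentSpace 𝓘(ℝ, EQ) q),
    form (g • q) (mfderiv 𝓘(ℝ, EQ) 𝓘(ℝ, EQ) (fun x : Q => g • x) q v) = adjointMap g (form q v)

end Connections

/-! ### The reduced system -/

section Reduction

variable {EQ EB EG G Q : Type*}
  [NormedAddCommGroup EQ] [NormedSpace ℝ EQ]
  [NormedAddCommGroup EG] [NormedSpace ℝ EG]
  [TopologicalSpace G] [ChartedSpace EG G] [Group G]
  [TopologicalSpace Q] [ChartedSpace EQ Q] [MulAction G Q]

/-- The map `Ψ̃ (q₀, w₀, τ₁) = (q₀, q₁)`, where `q₁` is the point of the orbit `τ₁` with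
`A_d (q₀, q₁) = w₀`. It does not depend on the point of `τ₁` used to write it and is inverse
to `(q₀, q₁) ↦ (q₀, A_d (q₀, q₁), π q₁)`. -/
def AffineDiscreteConnection.psiTilde (A : AffineDiscreteConnection EQ EG G Q)
    (p : Q × G × OrbitSpace G Q) : Q × Q :=
  (p.1, (p.2.1 * (A.conn (p.1, p.2.2.out))⁻¹) • p.2.2.out)

theorem AffineDiscreteConnection.psiTilde_conj (A : AffineDiscreteConnection EQ EG G Q)
    (g : G) (q : Q) (w : G) (τ : OrbitSpace G Q) :
    A.psiTilde (g • q, g * w * g⁻¹, τ) = g • A.psiTilde (q, w, τ) := by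
  have h := A.conn_smul g 1 q τ.out
  rw [one_smul, one_mul] at h
  simp only [AffineDiscreteConnection.psiTilde, h, Prod.smul_mk, ← mul_smul]
  congr 2
  group

variable (EB) in
/-- The map `Υ (q₀, q₁) = (ρ (q₀, A_d (q₀, q₁)), π q₁)`. -/
def AffineDiscreteConnection.upsilon (A : AffineDiscreteConnection EQ EG G Q) (p : Q × Q) :
    ConjBundle EQ EB EG G Q × OrbitSpace G Q :=
  (conjMk EQ EB EG (p.1, A.conn p), orbitProj G p.2)

theorem AffineDiscreteConnection.upsilon_smul (A : AffineDiscreteConnection EQ EG G Q)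
    (g : G) (p : Q × Q) : A.upsilon EB (g • p) = A.upsilon EB p := by
  obtain ⟨q, q'⟩ := p
  simp only [AffineDiscreteConnection.upsilon, Prod.smul_mk, A.conn_smul, orbitProj_smul,
    conjMk_smul]

/-- The `G`-invariant Lagrangian on `Q × G × Q/G`. -/
def checkLagrangian [IsManifold 𝓘(ℝ, EQ) ∞ Q] (S : FDMS EQ Q)
    (A : AffineDiscreteConnection EQ EG G Q) (p : Q × G × OrbitSpace G Q) : ℝ :=
  S.lagrangian (A.psiTilde p)

variable (EB) in
/-- The reduced Lagrangian on `G̃ × Q/G`, induced on the quotient by `checkLagrangian`. -/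
def reducedLagrangian [IsManifold 𝓘(ℝ, EQ) ∞ Q] (S : FDMS EQ Q) (hS : S.IsSymmetric G)
    (A : AffineDiscreteConnection EQ EG G Q)
    (z : ConjBundle EQ EB EG G Q × OrbitSpace G Q) : ℝ :=
  Quotient.lift (s := conjSetoid G Q) (fun p => checkLagrangian S A (p.1, p.2, z.2))
    (by
      rintro ⟨q, w⟩ ⟨q', w'⟩ ⟨g, h1, h2⟩
      simp only at h1 h2
      simp only [checkLagrangian, ← h1, ← h2, A.psiTilde_conj, hS.lagrangian_smul]) z.1

variable [LieGroup 𝓘(ℝ, EG) ∞ G]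

variable (EG G Q) in
/-- The orbit relation of the action `g • ((q₀, q₁), ξ) = ((g • q₀, g • q₁), Ad_g ξ)`. -/
def adjointSetoid : Setoid ((Q × Q) × GroupLieAlgebra 𝓘(ℝ, EG) G) where
  r p p' := ∃ g : G, g • p.1 = p'.1 ∧ adjointMap g p.2 = p'.2
  iseqv :=
    { refl := fun p => ⟨1, one_smul _ _, adjointMap_one _⟩
      symm := by
        rintro ⟨p, ξ⟩ ⟨p', ξ'⟩ ⟨g, h1, h2⟩
        simp only at h1 h2
        refine ⟨g⁻¹, by simp [← h1], ?_⟩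
        simp only
        rw [← h2, ← adjointMap_mul, inv_mul_cancel, adjointMap_one]
      trans := by
        rintro ⟨p, ξ⟩ ⟨p', ξ'⟩ ⟨p'', ξ''⟩ ⟨g, h1, h2⟩ ⟨k, h3, h4⟩
        simp only at h1 h2 h3 h4
        exact ⟨k * g, by simp [mul_smul, h1, h3], by simp [adjointMap_mul, h2, h4]⟩ }

variable (EG G Q) in
/-- The adjoint bundle `(Q × Q × 𝔤)/G` of `Q × Q → (Q × Q)/G`. -/
def AdjointBundle : Type _ := Quotient (adjointSetoid EG G Q)

/-- The class `[(q₀, q₁), ξ]`. -/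
def adjointMk (p : Q × Q) (ξ : GroupLieAlgebra 𝓘(ℝ, EG) G) : AdjointBundle EG G Q :=
  Quotient.mk (adjointSetoid EG G Q) (p, ξ)

variable (EB) in
/-- The projection `[(q₀, q₁), ξ] ↦ Υ (q₀, q₁)` of the adjoint bundle to `G̃ × Q/G`. -/
def adjointBase (A : AffineDiscreteConnection EQ EG G Q) (a : AdjointBundle EG G Q) :
    ConjBundle EQ EB EG G Q × OrbitSpace G Q :=
  Quotient.lift (s := adjointSetoid EG G Q) (fun p => A.upsilon EB p.1)
    (by
      rintro p p' ⟨g, h1, -⟩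
      simp only [← h1, A.upsilon_smul]) a

/-- The fiber over a point of `G̃ × Q/G` of the pulled back adjoint bundle. -/
def AdjointFiber (A : AffineDiscreteConnection EQ EG G Q)
    (z : ConjBundle EQ EB EG G Q × OrbitSpace G Q) : Type _ :=
  {a : AdjointBundle EG G Q // adjointBase EB A a = z}

variable [NormedAddCommGroup EB] [NormedSpace ℝ EB] [ChartedSpace EB (OrbitSpace G Q)]
  [IsManifold 𝓘(ℝ, EQ) ∞ Q]

/-- The horizontal lift `h^q : T_{π q}(Q/G) → T_q Q`: the vector `h^q u` is the solution `v` of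
`Tπ v = u` and `𝔄 v = 0`. -/
def PrincipalConnection.horLift (P : PrincipalConnection EQ EG G Q) (q : Q) :
    TangentSpace 𝓘(ℝ, EB) (orbitProj G q) →L[ℝ] TangentSpace 𝓘(ℝ, EQ) q :=
  (((mfderiv 𝓘(ℝ, EQ) 𝓘(ℝ, EB) (orbitProj G) q).prod (P.form q)).inverse).comp
    (ContinuousLinearMap.inl ℝ _ _)

/-- The principal connection `½ (pr₁^* 𝔄 + pr₂^* 𝔄)` on `Q × Q → (Q × Q)/G`. -/
def PrincipalConnection.diag (P : PrincipalConnection EQ EG G Q) (p : Q × Q) :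
    TangentSpace (𝓘(ℝ, EQ).prod 𝓘(ℝ, EQ)) p →L[ℝ] GroupLieAlgebra 𝓘(ℝ, EG) G :=
  (1 / 2 : ℝ) • ((P.form p.1).comp (fstT p.1 p.2) + (P.form p.2).comp (sndT p.1 p.2))

/-- The discrete force on `Q × G × Q/G`: the pullback of `f_d` by `Ψ̃`. -/
def checkForce (EB : Type*) [NormedAddCommGroup EB] [NormedSpace ℝ EB]
    [ChartedSpace EB (OrbitSpace G Q)] (S : FDMS EQ Q) (A : AffineDiscreteConnection EQ EG G Q)
    (p : Q × G × OrbitSpace G Q) :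
    TangentSpace (𝓘(ℝ, EQ).prod (𝓘(ℝ, EG).prod 𝓘(ℝ, EB))) p →L[ℝ] ℝ :=
  (S.force.toFun (A.psiTilde p)).comp
    (mfderiv (𝓘(ℝ, EQ).prod (𝓘(ℝ, EG).prod 𝓘(ℝ, EB))) (𝓘(ℝ, EQ).prod 𝓘(ℝ, EQ)) A.psiTilde p)

section Components

variable {q : Q} {w : G} {τ : OrbitSpace G Q}

/-- The first component of a covector on `Q × G × Q/G`. -/
def covec₁ (α : TangentSpace (𝓘(ℝ, EQ).prod (𝓘(ℝ, EG).prod 𝓘(ℝ, EB))) (q, w, τ) →L[ℝ] ℝ) :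
    TangentSpace 𝓘(ℝ, EQ) q →L[ℝ] ℝ :=
  α.comp (inlT q (w, τ))

/-- The second component of a covector on `Q × G × Q/G`. -/
def covec₂ (α : TangentSpace (𝓘(ℝ, EQ).prod (𝓘(ℝ, EG).prod 𝓘(ℝ, EB))) (q, w, τ) →L[ℝ] ℝ) :
    TangentSpace 𝓘(ℝ, EG) w →L[ℝ] ℝ :=
  α.comp ((inrT q (w, τ)).comp (inlT w τ))

/-- The third component of a covector on `Q × G × Q/G`. -/
def covec₃ (α : TangentSpace (𝓘(ℝ, EQ).prod (𝓘(ℝ, EG).prod 𝓘(ℝ, EB))) (q, w, τ) →L[ℝ] ℝ) :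
    TangentSpace 𝓘(ℝ, EB) τ →L[ℝ] ℝ :=
  α.comp ((inrT q (w, τ)).comp (inrT w τ))

end Components

/-- `D₁ A_d (q₀, q₁)`. -/
def AffineDiscreteConnection.D₁ (A : AffineDiscreteConnection EQ EG G Q) (q₀ q₁ : Q) :
    TangentSpace 𝓘(ℝ, EQ) q₀ →L[ℝ] TangentSpace 𝓘(ℝ, EG) (A.conn (q₀, q₁)) :=
  (mfderiv (𝓘(ℝ, EQ).prod 𝓘(ℝ, EQ)) 𝓘(ℝ, EG) A.conn (q₀, q₁)).comp (inlT q₀ q₁)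

/-- `D₂ A_d (q₀, q₁)`. -/
def AffineDiscreteConnection.D₂ (A : AffineDiscreteConnection EQ EG G Q) (q₀ q₁ : Q) :
    TangentSpace 𝓘(ℝ, EQ) q₁ →L[ℝ] TangentSpace 𝓘(ℝ, EG) (A.conn (q₀, q₁)) :=
  (mfderiv (𝓘(ℝ, EQ).prod 𝓘(ℝ, EQ)) 𝓘(ℝ, EG) A.conn (q₀, q₁)).comp (inrT q₀ q₁)

/-- The differential of `checkLagrangian` at `(q₀, A_d (q₀, q₁), π q₁)`. -/
def dCheckLagrangian (EB : Type*) [NormedAddCommGroup EB] [NormedSpace ℝ EB]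
    [ChartedSpace EB (OrbitSpace G Q)] (S : FDMS EQ Q) (A : AffineDiscreteConnection EQ EG G Q)
    (q₀ q₁ : Q) :
    TangentSpace (𝓘(ℝ, EQ).prod (𝓘(ℝ, EG).prod 𝓘(ℝ, EB)))
      (q₀, A.conn (q₀, q₁), orbitProj G q₁) →L[ℝ] ℝ :=
  differential (𝓘(ℝ, EQ).prod (𝓘(ℝ, EG).prod 𝓘(ℝ, EB))) (checkLagrangian S A)
    (q₀, A.conn (q₀, q₁), orbitProj G q₁)

/-- `checkForce` at `(q₀, A_d (q₀, q₁), π q₁)`. -/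
def checkForceAt (EB : Type*) [NormedAddCommGroup EB] [NormedSpace ℝ EB]
    [ChartedSpace EB (OrbitSpace G Q)] (S : FDMS EQ Q) (A : AffineDiscreteConnection EQ EG G Q)
    (q₀ q₁ : Q) :
    TangentSpace (𝓘(ℝ, EQ).prod (𝓘(ℝ, EG).prod 𝓘(ℝ, EB)))
      (q₀, A.conn (q₀, q₁), orbitProj G q₁) →L[ℝ] ℝ :=
  checkForce EB S A (q₀, A.conn (q₀, q₁), orbitProj G q₁)

/-- The covector `φ` at `π b`, for three consecutive points `a, b, c` of a discrete curve. -/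
def phi (EB : Type*) [NormedAddCommGroup EB] [NormedSpace ℝ EB]
    [ChartedSpace EB (OrbitSpace G Q)] (S : FDMS EQ Q) (A : AffineDiscreteConnection EQ EG G Q)
    (P : PrincipalConnection EQ EG G Q) (a b c : Q) :
    TangentSpace 𝓘(ℝ, EB) (orbitProj G b) →L[ℝ] ℝ :=
  (covec₁ (dCheckLagrangian EB S A b c)).comp (P.horLift b) +
  covec₃ (dCheckLagrangian EB S A a b) +
  (covec₂ (dCheckLagrangian EB S A b c)).comp ((A.D₁ b c).comp (P.horLift b)) +
  (covec₂ (dCheckLagrangian EB S A a b)).comp ((A.D₂ a b).comp (P.horLift b)) +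
  (covec₁ (checkForceAt EB S A b c)).comp (P.horLift b) +
  covec₃ (checkForceAt EB S A a b) +
  (covec₂ (checkForceAt EB S A b c)).comp ((A.D₁ b c).comp (P.horLift b)) +
  (covec₂ (checkForceAt EB S A a b)).comp ((A.D₂ a b).comp (P.horLift b))

/-- The element `ψ` of the dual of the Lie algebra, for three consecutive points `a, b, c` of a
discrete curve. For a covector `α` at `w`, the covector `α w⁻¹` at `1` is `ξ ↦ α (ξ w)`. -/
def psi (EB : Type*) [NormedAddCommGroup EB] [NormedSpace ℝ EB]
    [ChartedSpace EB (OrbitSpace G Q)] (S : FDMS EQ Q) (A : AffineDiscreteConnection EQ EG G Q)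
    (a b c : Q) : GroupLieAlgebra 𝓘(ℝ, EG) G →L[ℝ] ℝ :=
  ((covec₂ (dCheckLagrangian EB S A a b)).comp (rightTranslation (A.conn (a, b))) -
    (covec₂ (dCheckLagrangian EB S A b c)).comp (rightTranslation (A.conn (b, c)))) +
  (covec₁ (checkForceAt EB S A b c) + (covec₂ (checkForceAt EB S A b c)).comp (A.D₁ b c) +
    (covec₂ (checkForceAt EB S A a b)).comp (A.D₂ a b)).comp (infGen b)

/-- The explicit reduced equations: `φ = 0` and `ψ = 0` at `q₁, …, q_{N-1}`. -/
def ReducedEquations (EB : Type*) [NormedAddCommGroup EB] [NormedSpace ℝ EB]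
    [ChartedSpace EB (OrbitSpace G Q)] (S : FDMS EQ Q) (A : AffineDiscreteConnection EQ EG G Q)
    (P : PrincipalConnection EQ EG G Q) {N : ℕ} (q : Fin (N + 1) → Q) : Prop :=
  ∀ (k : ℕ) (_ : 1 ≤ k) (_ : k < N),
    phi EB S A P (q ⟨k - 1, by omega⟩) (q ⟨k, by omega⟩) (q ⟨k + 1, by omega⟩) = 0 ∧
    ∀ ξ : GroupLieAlgebra 𝓘(ℝ, EG) G,
      psi EB S A (q ⟨k - 1, by omega⟩) (q ⟨k, by omega⟩) (q ⟨k + 1, by omega⟩) ξ = 0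

variable [IsPrincipalBundle EQ EB EG G Q]

/-- The isomorphism `(δq₀, δq₁) ↦ TΥ (δq₀, δq₁) ⊕ ½ (𝔄 δq₀ + 𝔄 δq₁)`. -/
def splitting (EB : Type*) [NormedAddCommGroup EB] [NormedSpace ℝ EB]
    [ChartedSpace EB (OrbitSpace G Q)] [IsPrincipalBundle EQ EB EG G Q]
    (A : AffineDiscreteConnection EQ EG G Q) (P : PrincipalConnection EQ EG G Q) (p : Q × Q) :
    TangentSpace (𝓘(ℝ, EQ).prod 𝓘(ℝ, EQ)) p →L[ℝ]
      TangentSpace ((𝓘(ℝ, EB).prod 𝓘(ℝ, EG)).prod 𝓘(ℝ, EB)) (A.upsilon EB p) ×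
        GroupLieAlgebra 𝓘(ℝ, EG) G :=
  (mfderiv (𝓘(ℝ, EQ).prod 𝓘(ℝ, EQ)) ((𝓘(ℝ, EB).prod 𝓘(ℝ, EG)).prod 𝓘(ℝ, EB))
    (A.upsilon EB) p).prod (P.diag p)

/-- The reduced force: the value of `f̂_d z` at `δ ⊕ a` is `f_d p u`, where `a = [p, ξ]` and `u` is
the tangent vector at `p` with `TΥ u = δ` and `½ (𝔄 u₀ + 𝔄 u₁) = ξ`. By the invariance of the
force it does not depend on the representative `(p, ξ)` of `a`. -/
def reducedForce (S : FDMS EQ Q) (A : AffineDiscreteConnection EQ EG G Q)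
    (P : PrincipalConnection EQ EG G Q) (z : ConjBundle EQ EB EG G Q × OrbitSpace G Q)
    (δ : TangentSpace ((𝓘(ℝ, EB).prod 𝓘(ℝ, EG)).prod 𝓘(ℝ, EB)) z)
    (a : AdjointFiber A z) : ℝ :=
  let r := Quotient.out (s := adjointSetoid EG G Q) a.1
  have hr : z = A.upsilon EB r.1 := by
    rw [← a.2]
    exact (congrArg (adjointBase EB A) (Quotient.out_eq a.1)).symm
  S.force.toFun r.1 ((splitting EB A P r.1).inverse (castT hr δ, r.2))

/-- The reduced action functional on discrete curves of `G̃ × Q/G`. -/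
def reducedAction (S : FDMS EQ Q) (hS : S.IsSymmetric G) (A : AffineDiscreteConnection EQ EG G Q)
    {N : ℕ} (z : Fin N → ConjBundle EQ EB EG G Q × OrbitSpace G Q) : ℝ :=
  ∑ k : Fin N, reducedLagrangian EB S hS A (z k)

variable (EB) in
/-- The reduced curve `(v_k, τ_{k+1})`, `0 ≤ k ≤ N - 1`, of a discrete curve. -/
def reducedCurve (A : AffineDiscreteConnection EQ EG G Q) {N : ℕ} (q : Fin (N + 1) → Q) :
    Fin N → ConjBundle EQ EB EG G Q × OrbitSpace G Q :=
  fun k => (conjMk EQ EB EG (q k.castSucc, A.conn (q k.castSucc, q k.succ)), orbitProj G (q k.succ))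

/-- The vector `T ρ (u₀, T A_d (u₀, u₁))` of `G̃`, for tangent vectors `u₀`, `u₁` of `Q`. -/
def conjVariation (EB : Type*) [NormedAddCommGroup EB] [NormedSpace ℝ EB]
    [ChartedSpace EB (OrbitSpace G Q)] [IsPrincipalBundle EQ EB EG G Q]
    (A : AffineDiscreteConnection EQ EG G Q) {q₀ q₁ : Q}
    (u₀ : TangentSpace 𝓘(ℝ, EQ) q₀) (u₁ : TangentSpace 𝓘(ℝ, EQ) q₁) :
    TangentSpace (𝓘(ℝ, EB).prod 𝓘(ℝ, EG)) (conjMk EQ EB EG (q₀, A.conn (q₀, q₁))) :=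
  mfderiv (𝓘(ℝ, EQ).prod 𝓘(ℝ, EG)) (𝓘(ℝ, EB).prod 𝓘(ℝ, EG)) (conjMk EQ EB EG)
    (q₀, A.conn (q₀, q₁))
    (pairT u₀ (mfderiv (𝓘(ℝ, EQ).prod 𝓘(ℝ, EQ)) 𝓘(ℝ, EG) A.conn (q₀, q₁) (pairT u₀ u₁)))

/-- The reduced Lagrange-d'Alembert principle with constrained variations. -/
def ReducedVariationalPrinciple (EB : Type*) [NormedAddCommGroup EB] [NormedSpace ℝ EB]
    [ChartedSpace EB (OrbitSpace G Q)] [IsPrincipalBundle EQ EB EG G Q]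
    (S : FDMS EQ Q) (hS : S.IsSymmetric G) (A : AffineDiscreteConnection EQ EG G Q)
    (P : PrincipalConnection EQ EG G Q) {N : ℕ} (q : Fin (N + 1) → Q) : Prop :=
  ∀ (δτ : ∀ k, TangentSpace 𝓘(ℝ, EB) (orbitProj G (q k)))
    (ξ : Fin (N + 1) → GroupLieAlgebra 𝓘(ℝ, EG) G)
    (δv : ∀ k : Fin N, TangentSpace (𝓘(ℝ, EB).prod 𝓘(ℝ, EG)) (reducedCurve EB A q k).1),
    (∀ k : Fin N, δv k =
      conjVariation EB A (P.horLift (q k.castSucc) (δτ k.castSucc))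
        (P.horLift (q k.succ) (δτ k.succ)) +
      conjVariation EB A (infGen (q k.castSucc) (ξ k.castSucc))
        (infGen (q k.succ) (ξ k.succ))) →
    δτ 0 = 0 → δτ (Fin.last N) = 0 → ξ 0 = 0 → ξ (Fin.last N) = 0 →
    differential (ModelWithCorners.pi fun _ : Fin N => (𝓘(ℝ, EB).prod 𝓘(ℝ, EG)).prod 𝓘(ℝ, EB))
        (reducedAction S hS A) (reducedCurve EB A q)
        (familyT fun k => pairT (δv k) (δτ k.succ)) +
      ∑ k : Fin N, reducedForce S A P (reducedCurve EB A q k) (pairT (δv k) (δτ k.succ))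
        ⟨adjointMk (q k.castSucc, q k.succ) ((1 / 2 : ℝ) • (ξ k.castSucc + ξ k.succ)), rfl⟩ = 0

end Reduction

end ForcedReduction

end

open ForcedReduction

/-!
Both variational principles and both systems of equations are statements about the covector
`dL_d + f_d` on `Q × Q` (`FDMS.forcedDifferential`), evaluated at the consecutive pairs of the
curve.

*Unreduced side.* The variation of the action along `δq` is the sum of the values of
`dL_d + f_d` at `(δq_k, δq_{k+1})`. Summation by parts turns it into a sum over interior points
of the Euler-Lagrange covectors, and variations of a single point separate these.

*Reduced variational principle.* Each tangent vector of `Q` is uniquely `h^q δτ + ξ_Q (q)`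
(`PrincipalConnection.horLift_add_infGen`), so the constrained variations of the reduced curve are
exactly the images under `TΥ` of the variations of `q`. Since `L̂_d ∘ Υ = L_d`, the Lagrangian
terms agree. The force terms agree because the reduced force is determined by `f_d` through the
isomorphism `TΥ ⊕ ½ (𝔄 + 𝔄)`, and does not depend on the representative chosen in the adjoint
bundle (`reducedForce_apply`).

*Both isomorphisms.* The maps `π : Q → Q/G` and `Υ : Q × Q → G̃ × Q/G` are invariant and have
smooth local sections `σ` for which the points near a given `x` are `y = κ y • σ (pr y)` with `κ`
smooth and `κ x = 1`. Differentiating this relation shows that `T pr ⊕ θ` is invertible for every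
form `θ` that reproduces the infinitesimal generators
(`isInvertible_prod_of_local_section`). The section of `Υ` comes from `Ψ̃` and a local
trivialization of `Q`. It also shows that `L̂_d` is smooth.

*Explicit equations.* The Euler-Lagrange covector is restricted to horizontal and to vertical
vectors. As `Ψ̃` inverts `(q₀, q₁) ↦ (q₀, A_d (q₀, q₁), π q₁)`, the chain rule expresses it by the
components of `dĽ_d` and `f̌_d` (`eulerLagrange_eq_covec`). On horizontal vectors this is `φ`. On
a generator `ξ_Q` it is `ψ (ξ)`, because `D₂ A_d` sends `ξ_Q (q₁)` to `ξ w`, and because `dL_d`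
vanishes on the generators of the diagonal action.
-/

noncomputable section

namespace ForcedReduction

/-! ### Derivatives between model spaces -/

section ModelDeriv

variable {E F E' : Type*} [NormedAddCommGroup E] [NormedSpace ℝ E]
  [NormedAddCommGroup F] [NormedSpace ℝ F] [NormedAddCommGroup E'] [NormedSpace ℝ E']
  {H K H' : Type*} [TopologicalSpace H] [TopologicalSpace K] [TopologicalSpace H']
  {I : ModelWithCorners ℝ E H} {J : ModelWithCorners ℝ F K} {I' : ModelWithCorners ℝ E' H'}
  {M N X : Type*} [TopologicalSpace M] [ChartedSpace H M] [TopologicalSpace N] [ChartedSpace K N]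
  [TopologicalSpace X] [ChartedSpace H' X]

variable (I J) in
/-- The derivative of `f` at `x` as a map of the model vector spaces. Since its type does not
depend on `x`, base points can be rewritten freely. -/
def modelDeriv (f : M → N) (x : M) : E →L[ℝ] F :=
  mfderiv I J f x

theorem modelDeriv_comp {g : N → X} {f : M → N} {x : M} {y : N}
    (hg : MDifferentiableAt J I' g y) (hf : MDifferentiableAt I J f x) (h : f x = y) :
    modelDeriv I I' (fun z => g (f z)) x = (modelDeriv J I' g y).comp (modelDeriv I J f x) := by
  subst h
  exact mfderiv_comp x hg hf

theorem modelDeriv_congr {f f' : M → N} {x : M} (h : f =ᶠ[𝓝 x] f') :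
    modelDeriv I J f x = modelDeriv I J f' x :=
  h.mfderiv_eq

theorem modelDeriv_id (x : M) : modelDeriv I I (fun z : M => z) x = ContinuousLinearMap.id ℝ E :=
  mfderiv_id

theorem modelDeriv_const (x : M) (y : N) : modelDeriv I J (fun _ : M => y) x = 0 :=
  mfderiv_const

theorem modelDeriv_prodMk {f : M → N} {g : M → X} {x : M} (hf : MDifferentiableAt I J f x)
    (hg : MDifferentiableAt I I' g x) :
    modelDeriv I (J.prod I') (fun z => (f z, g z)) x =
      (modelDeriv I J f x).prod (modelDeriv I I' g x) :=
  mfderiv_prodMk hf hg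

theorem modelDeriv_fst (p : M × N) :
    modelDeriv (I.prod J) I (fun z : M × N => z.1) p = ContinuousLinearMap.fst ℝ E F :=
  mfderiv_fst

theorem modelDeriv_snd (p : M × N) :
    modelDeriv (I.prod J) J (fun z : M × N => z.2) p = ContinuousLinearMap.snd ℝ E F :=
  mfderiv_snd

/-- The coordinate functions of a finite power of a manifold are differentiable, and their
derivatives are the coordinate projections. -/
theorem hasMFDerivAt_eval {n : ℕ} (x : Fin n → M) (k : Fin n) :
    HasMFDerivAt (ModelWithCorners.pi fun _ : Fin n => I) I (fun y : Fin n → M => y k) x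
      (ContinuousLinearMap.proj (R := ℝ) (φ := fun _ : Fin n => E) k) := by
  refine ⟨(continuous_apply k).continuousAt, ?_⟩
  have hp : HasFDerivWithinAt (fun y : Fin n → E => y k)
      (ContinuousLinearMap.proj (R := ℝ) (φ := fun _ : Fin n => E) k)
      (range (ModelWithCorners.pi fun _ : Fin n => I))
      (extChartAt (ModelWithCorners.pi fun _ : Fin n => I) x x) :=
    (ContinuousLinearMap.proj (R := ℝ) (φ := fun _ : Fin n => E) k).hasFDerivWithinAt
  have ht : Filter.Tendsto (fun y : Fin n → E => y k)
      (𝓝[range (ModelWithCorners.pi fun _ : Fin n => I)]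
        (extChartAt (ModelWithCorners.pi fun _ : Fin n => I) x x))
      (𝓝[range I] (extChartAt I (x k) (x k))) := by
    refine tendsto_nhdsWithin_iff.2 ⟨?_, ?_⟩
    · exact ((continuous_apply k).tendsto _).mono_left nhdsWithin_le_nhds
    · filter_upwards [self_mem_nhdsWithin] with y hy
      obtain ⟨z, rfl⟩ := hy
      exact ⟨z k, rfl⟩
  refine hp.congr_of_eventuallyEq ?_ ?_
  · filter_upwards [ht (extChartAt_target_mem_nhdsWithin (I := I) (x k))] with y hy
    exact (extChartAt I (x k)).right_inv hy
  · exact (extChartAt I (x k)).right_inv (mem_extChartAt_target (I := I) (x k))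

/-- The shape of both action functionals: a sum of values of one function `f` at points `c y k`
extracted from the curve `y`. -/
theorem differential_sum_comp {n m : ℕ} (f : N → ℝ) (c : (Fin n → M) → Fin m → N)
    (c' : Fin m → (Fin n → E) →L[ℝ] F) (x : Fin n → M)
    (hf : ∀ k, MDifferentiableAt J 𝓘(ℝ, ℝ) f (c x k))
    (hc : ∀ k, HasMFDerivAt (ModelWithCorners.pi fun _ : Fin n => I) J (fun y => c y k) x (c' k))
    (v : Fin n → E) :
    modelDeriv (ModelWithCorners.pi fun _ : Fin n => I) 𝓘(ℝ, ℝ) (fun y => ∑ k, f (c y k)) x v =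
      ∑ k, modelDeriv J 𝓘(ℝ, ℝ) f (c x k) (c' k v) := by
  have h : HasMFDerivAt (ModelWithCorners.pi fun _ : Fin n => I) 𝓘(ℝ, ℝ)
      (∑ k, fun y => f (c y k)) x
      (∑ k, ((modelDeriv J 𝓘(ℝ, ℝ) f (c x k)).comp (c' k) : (Fin n → E) →L[ℝ] ℝ)) :=
    HasMFDerivAt.sum (t := Finset.univ) fun k _ => (hf k).hasMFDerivAt.comp x (hc k)
  have h' : (fun y => ∑ k, f (c y k)) = (∑ k, fun y => f (c y k)) := by
    ext y; simp
  have hd : modelDeriv (ModelWithCorners.pi fun _ : Fin n => I) 𝓘(ℝ, ℝ)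
      (∑ k, fun y => f (c y k)) x =
      ∑ k, (modelDeriv J 𝓘(ℝ, ℝ) f (c x k)).comp (c' k) := h.mfderiv
  rw [h', hd]
  simp

end ModelDeriv

/-! ### Invariant submersions -/

section Action

variable {EG G : Type*} [NormedAddCommGroup EG] [NormedSpace ℝ EG]
  [TopologicalSpace G] [ChartedSpace EG G] [Group G]
  {E F : Type*} [NormedAddCommGroup E] [NormedSpace ℝ E] [NormedAddCommGroup F] [NormedSpace ℝ F]
  {H K : Type*} [TopologicalSpace H] [TopologicalSpace K]
  {I : ModelWithCorners ℝ E H} {J : ModelWithCorners ℝ F K}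
  {M X : Type*} [TopologicalSpace M] [ChartedSpace H M] [TopologicalSpace X] [ChartedSpace K X]
  [MulAction G M]

theorem mdifferentiable_smul_point
    (hact : ContMDiff (𝓘(ℝ, EG).prod I) I ∞ fun p : G × M => p.1 • p.2) (x : M) :
    MDifferentiable 𝓘(ℝ, EG) I fun g : G => g • x :=
  (hact.comp (contMDiff_id.prodMk contMDiff_const)).mdifferentiable (by simp)

theorem mdifferentiable_smul_left
    (hact : ContMDiff (𝓘(ℝ, EG).prod I) I ∞ fun p : G × M => p.1 • p.2) (g : G) :
    MDifferentiable I I fun x : M => g • x :=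
  (hact.comp (contMDiff_const.prodMk contMDiff_id)).mdifferentiable (by simp)

theorem modelDeriv_smul_one
    (hact : ContMDiff (𝓘(ℝ, EG).prod I) I ∞ fun p : G × M => p.1 • p.2) (x : M)
    (a : EG) (u : E) :
    modelDeriv (𝓘(ℝ, EG).prod I) I (fun p : G × M => p.1 • p.2) (1, x) (a, u) =
      modelDeriv 𝓘(ℝ, EG) I (fun g : G => g • x) 1 a + u := by
  have hm : MDifferentiableAt (𝓘(ℝ, EG).prod I) I (fun p : G × M => p.1 • p.2) (1, x) :=
    hact.mdifferentiable (by simp) _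
  have h1 := modelDeriv_comp (I := 𝓘(ℝ, EG)) (f := fun g : G => (g, x)) (x := 1) hm
    (mdifferentiableAt_id.prodMk mdifferentiableAt_const) rfl
  have h2 := modelDeriv_comp (I := I) (f := fun y : M => ((1 : G), y)) (x := x) hm
    (mdifferentiableAt_const.prodMk mdifferentiableAt_id) rfl
  rw [modelDeriv_prodMk (f := fun g : G => g) mdifferentiableAt_id mdifferentiableAt_const,
    modelDeriv_id, modelDeriv_const] at h1
  rw [modelDeriv_prodMk (g := fun y : M => y) mdifferentiableAt_const mdifferentiableAt_id,
    modelDeriv_id, modelDeriv_const] at h2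
  simp only [one_smul] at h2
  rw [modelDeriv_id] at h2
  have h3 := congrArg (fun l => l a) h1
  have h4 := congrArg (fun l => l u) h2
  simp at h3 h4
  have h5 : ((a, u) : EG × E) = (a, 0) + (0, u) := by simp
  rw [h5, map_add, h3, ← h4]

theorem modelDeriv_invariant_orbit
    (hact : ContMDiff (𝓘(ℝ, EG).prod I) I ∞ fun p : G × M => p.1 • p.2) {x : M}
    {pr : M → X} (hinv : ∀ (g : G) (y : M), pr (g • y) = pr y) (hpr : MDifferentiableAt I J pr x)
    (ξ : EG) :
    modelDeriv I J pr x (modelDeriv 𝓘(ℝ, EG) I (fun g : G => g • x) 1 ξ) = 0 := by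
  have h := modelDeriv_comp hpr (mdifferentiable_smul_point hact x 1) (one_smul G x)
  simp only [hinv] at h
  rw [modelDeriv_const] at h
  exact (congrArg (fun l => l ξ) h).symm

/-- Let `σ` be a local section of the invariant map `pr`, and write the points near `x` as
`y = κ y • σ (pr y)` with `κ x = 1`. Differentiating this identity shows that every vector at `x` is
the sum of a vertical vector and a vector in the image of `Tσ`. Hence `Tpr ⊕ θ` is invertible
for every form `θ` reproducing the infinitesimal generators. -/
theorem isInvertible_prod_of_local_section
    (hact : ContMDiff (𝓘(ℝ, EG).prod I) I ∞ fun p : G × M => p.1 • p.2) {x : M}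
    {pr : M → X} (hinv : ∀ (g : G) (y : M), pr (g • y) = pr y) (hpr : MDifferentiableAt I J pr x)
    {κ : M → G} (hκ : MDifferentiableAt I 𝓘(ℝ, EG) κ x) (hκx : κ x = 1)
    {σ : X → M} (hσ : MDifferentiableAt J I σ (pr x)) (hσx : σ (pr x) = x)
    (hsec : ∀ᶠ z in 𝓝 (pr x), pr (σ z) = z) (hdec : ∀ᶠ y in 𝓝 x, κ y • σ (pr y) = y)
    (θ : E →L[ℝ] EG) (hθ : ∀ ξ, θ (modelDeriv 𝓘(ℝ, EG) I (fun g : G => g • x) 1 ξ) = ξ) :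
    ((modelDeriv I J pr x).prod θ).IsInvertible := by
  set T := modelDeriv I J pr x with hT
  set s := modelDeriv J I σ (pr x) with hs
  set ι := modelDeriv 𝓘(ℝ, EG) I (fun g : G => g • x) 1 with hι
  set k := modelDeriv I 𝓘(ℝ, EG) κ x with hk
  have h1 : T.comp s = ContinuousLinearMap.id ℝ F := by
    rw [hT, hs, ← modelDeriv_comp hpr hσ hσx, ← modelDeriv_id (I := J) (pr x)]
    exact modelDeriv_congr hsec
  have h1' : ∀ w, T (s w) = w := fun w => congrArg (fun l => l w) h1
  have h2 : ∀ ξ, T (ι ξ) = 0 := modelDeriv_invariant_orbit hact hinv hpr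
  have h3 : ∀ v, ι (k v) + s (T v) = v := by
    intro v
    have hσpr : MDifferentiableAt I I (fun y => σ (pr y)) x := hσ.comp x hpr
    have hm : MDifferentiableAt (𝓘(ℝ, EG).prod I) I (fun p : G × M => p.1 • p.2) (1, x) :=
      hact.mdifferentiable (by simp) _
    have hc := modelDeriv_comp hm (hκ.prodMk hσpr) (by rw [hκx, hσx])
    rw [modelDeriv_congr (f' := fun y => y) hdec, modelDeriv_id, modelDeriv_prodMk hκ hσpr,
      modelDeriv_comp hσ hpr rfl] at hc
    have hv := congrArg (fun l => l v) hc
    refine Eq.trans ?_ hv.symm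
    exact (modelDeriv_smul_one hact x _ _).symm
  have h4 : ∀ v, θ v = k v + θ (s (T v)) := by
    intro v
    conv_lhs => rw [← h3 v, map_add, hθ]
  -- The inverse sends `(w, ξ)` to the lift `s w`, corrected by a vertical vector so as to lie in
  -- the kernel of `θ`, plus the vertical vector `ι ξ`.
  refine ContinuousLinearMap.IsInvertible.of_inverse
    (g := (s - ι.comp (θ.comp s)).comp (ContinuousLinearMap.fst ℝ F EG) +
      ι.comp (ContinuousLinearMap.snd ℝ F EG)) ?_ ?_
  · ext w
    · simp [h1', h2]
    · simp [hθ]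
    · simp [h2]
    · simp [hθ]
  · ext v
    simp only [ContinuousLinearMap.comp_apply, add_apply,
      sub_apply, ContinuousLinearMap.prod_apply,
      ContinuousLinearMap.coe_fst', ContinuousLinearMap.coe_snd', ContinuousLinearMap.id_apply]
    rw [h4 v, map_add]
    conv_rhs => rw [← h3 v]
    abel

end Action

/-! ### Smoothness of the quotient maps -/

section PrincipalBundle

variable {EQ EB EG G Q : Type*}
  [NormedAddCommGroup EQ] [NormedSpace ℝ EQ] [NormedAddCommGroup EB] [NormedSpace ℝ EB]
  [NormedAddCommGroup EG] [NormedSpace ℝ EG]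
  [TopologicalSpace G] [ChartedSpace EG G] [Group G]
  [TopologicalSpace Q] [ChartedSpace EQ Q] [MulAction G Q]
  [ChartedSpace EB (OrbitSpace G Q)]

namespace LocalTriv

theorem smul_invFun (t : LocalTriv EQ EB EG G Q) {b : OrbitSpace G Q} (hb : b ∈ t.baseSet)
    (g h : G) : g • t.invFun (b, h) = t.invFun (b, g * h) := by
  obtain ⟨h1, h2, h3⟩ := t.symm_mem hb h
  have h4 : g • t.invFun (b, h) ∈ t.source := by
    rw [t.mem_source_iff, orbitProj_smul, h2]; exact hb
  have h5 : t.toFun (g • t.invFun (b, h)) = (b, g * h) := by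
    refine Prod.ext ?_ ?_
    · rw [t.fst_apply _ h4, orbitProj_smul, h2]
    · rw [t.snd_smul g _ h1, h3]
  rw [← h5]
  exact (t.left_inv' h4).symm

theorem invFun_orbitProj (t : LocalTriv EQ EB EG G Q) {q : Q} (hq : q ∈ t.source) :
    t.invFun (orbitProj G q, (t.toFun q).2) = q := by
  rw [← t.fst_apply q hq]
  exact t.left_inv' hq

theorem contMDiffAt_toFun (t : LocalTriv EQ EB EG G Q) {q : Q} (hq : q ∈ t.source) :
    ContMDiffAt 𝓘(ℝ, EQ) (𝓘(ℝ, EB).prod 𝓘(ℝ, EG)) ∞ t.toFun q :=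
  t.contMDiffOn_toFun.contMDiffAt (t.open_source.mem_nhds hq)

theorem contMDiffAt_invFun (t : LocalTriv EQ EB EG G Q) {b : OrbitSpace G Q}
    (hb : b ∈ t.baseSet) (g : G) :
    ContMDiffAt (𝓘(ℝ, EB).prod 𝓘(ℝ, EG)) 𝓘(ℝ, EQ) ∞ t.invFun (b, g) := by
  refine t.contMDiffOn_invFun.contMDiffAt (t.open_target.mem_nhds ?_)
  rw [t.target_eq]
  exact ⟨hb, trivial⟩

theorem contMDiffAt_section (t : LocalTriv EQ EB EG G Q) {b : OrbitSpace G Q}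
    (hb : b ∈ t.baseSet) (g : G) :
    ContMDiffAt 𝓘(ℝ, EB) 𝓘(ℝ, EQ) ∞ (fun b => t.invFun (b, g)) b :=
  (t.contMDiffAt_invFun hb g).comp (f := fun b => (b, g)) b
    (contMDiffAt_id.prodMk contMDiffAt_const)

end LocalTriv

variable (EQ EG G Q) in
theorem contMDiff_action (EB : Type*) [NormedAddCommGroup EB] [NormedSpace ℝ EB]
    [ChartedSpace EB (OrbitSpace G Q)] [IsPrincipalBundle EQ EB EG G Q] :
    ContMDiff (𝓘(ℝ, EG).prod 𝓘(ℝ, EQ)) 𝓘(ℝ, EQ) ∞ fun p : G × Q => p.1 • p.2 :=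
  (IsPrincipalBundle.contMDiffSMul (EB := EB)).contMDiff_smul

variable (EQ EG G Q) in
theorem contMDiff_diagAction (EB : Type*) [NormedAddCommGroup EB] [NormedSpace ℝ EB]
    [ChartedSpace EB (OrbitSpace G Q)] [IsPrincipalBundle EQ EB EG G Q] :
    ContMDiff (𝓘(ℝ, EG).prod (𝓘(ℝ, EQ).prod 𝓘(ℝ, EQ))) (𝓘(ℝ, EQ).prod 𝓘(ℝ, EQ)) ∞
      fun p : G × (Q × Q) => p.1 • p.2 :=
  ((contMDiff_action EQ EG G Q EB).comp
    (contMDiff_fst.prodMk (contMDiff_fst.comp contMDiff_snd))).prodMk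
  ((contMDiff_action EQ EG G Q EB).comp
    (contMDiff_fst.prodMk (contMDiff_snd.comp contMDiff_snd)))

variable (EQ EB G Q) in
theorem contMDiff_orbitProj (EG : Type*) [NormedAddCommGroup EG] [NormedSpace ℝ EG]
    [ChartedSpace EG G] [IsPrincipalBundle EQ EB EG G Q] :
    ContMDiff 𝓘(ℝ, EQ) 𝓘(ℝ, EB) ∞ (orbitProj G : Q → OrbitSpace G Q) := by
  intro q
  obtain ⟨t, ht⟩ := IsPrincipalBundle.exists_localTriv (EQ := EQ) (EB := EB) (EG := EG)
    (orbitProj G q)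
  have hq := (t.mem_source_iff q).2 ht
  refine ((contMDiff_fst.contMDiffAt).comp q (t.contMDiffAt_toFun hq)).congr_of_eventuallyEq ?_
  filter_upwards [t.open_source.mem_nhds hq] with y hy
  exact (t.fst_apply y hy).symm

variable [IsPrincipalBundle EQ EB EG G Q]

variable (EQ EB EG) in
theorem mem_localTrivAt_baseSet (b : OrbitSpace G Q) : b ∈ (localTrivAt EQ EB EG b).baseSet :=
  (IsPrincipalBundle.exists_localTriv (EQ := EQ) (EB := EB) (EG := EG) b).choose_spec

variable [LieGroup 𝓘(ℝ, EG) ∞ G]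

/-- A local trivialization `q ↦ (π q, c q)` gives the section of `π` on which `c` is constant, and
left translation relates it to the points near `q`. -/
theorem isInvertible_orbitProj_prod (EB : Type*) [NormedAddCommGroup EB] [NormedSpace ℝ EB]
    [ChartedSpace EB (OrbitSpace G Q)] [IsPrincipalBundle EQ EB EG G Q]
    (q : Q) (θ : EQ →L[ℝ] EG)
    (hθ : ∀ ξ, θ (modelDeriv 𝓘(ℝ, EG) 𝓘(ℝ, EQ) (fun g : G => g • q) 1 ξ) = ξ) :
    ((modelDeriv 𝓘(ℝ, EQ) 𝓘(ℝ, EB) (orbitProj G) q).prod θ).IsInvertible := by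
  obtain ⟨t, ht⟩ := IsPrincipalBundle.exists_localTriv (EQ := EQ) (EB := EB) (EG := EG)
    (orbitProj G q)
  have hq := (t.mem_source_iff q).2 ht
  refine isInvertible_prod_of_local_section (J := 𝓘(ℝ, EB)) (contMDiff_action EQ EG G Q EB)
    orbitProj_smul
    ((contMDiff_orbitProj EQ EB G Q EG).mdifferentiable (by simp) q)
    (κ := fun y => (t.toFun y).2 * (t.toFun q).2⁻¹)
    (σ := fun b => t.invFun (b, (t.toFun q).2)) ?_ (by simp) ?_ (t.invFun_orbitProj hq) ?_ ?_ θ hθ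
  · refine ContMDiffAt.mdifferentiableAt (n := ∞) ?_ (by simp)
    exact (contMDiff_snd.contMDiffAt.comp q (t.contMDiffAt_toFun hq)).mul contMDiffAt_const
  · exact (t.contMDiffAt_section ht _).mdifferentiableAt (by simp)
  · filter_upwards [t.open_baseSet.mem_nhds ht] with b hb
    exact (t.symm_mem hb _).2.1
  · filter_upwards [t.open_source.mem_nhds hq] with y hy
    rw [t.smul_invFun ((t.mem_source_iff y).1 hy), inv_mul_cancel_right, t.invFun_orbitProj hy]

theorem mem_conjChart_source (b : OrbitSpace G Q) {q : Q} (hq : orbitProj G q ∈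
    (localTrivAt EQ EB EG b).baseSet) (w : G) :
    conjMk EQ EB EG (q, w) ∈ (localTrivAt EQ EB EG b).conjChart.source :=
  ⟨(q, w), ⟨(LocalTriv.mem_source_iff _ q).2 hq, trivial⟩, rfl⟩

theorem conjChart_conjMk (b : OrbitSpace G Q) {q : Q} (hq : orbitProj G q ∈
    (localTrivAt EQ EB EG b).baseSet) (w : G) :
    (localTrivAt EQ EB EG b).conjChart (conjMk EQ EB EG (q, w)) =
      (localTrivAt EQ EB EG b).conjFun (q, w) :=
  LocalTriv.conjFun_out _ ((LocalTriv.mem_source_iff _ q).2 hq) w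

variable [IsManifold 𝓘(ℝ, EB) ∞ (OrbitSpace G Q)]

/-- The atlas of the conjugate bundle consists of the maps `e.trans f` with `f` a chart of
`Q/G × G`. Hence `e` is locally the composition of a chart with `f.symm`. -/
theorem contMDiffAt_conjChart (b : OrbitSpace G Q) {v : ConjBundle EQ EB EG G Q}
    (hv : v ∈ (localTrivAt EQ EB EG b).conjChart.source) :
    ContMDiffAt (𝓘(ℝ, EB).prod 𝓘(ℝ, EG)) (𝓘(ℝ, EB).prod 𝓘(ℝ, EG)) ∞
      (localTrivAt EQ EB EG b).conjChart v := by
  set e := (localTrivAt EQ EB EG b).conjChart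
  set f := chartAt (ModelProd EB EG) (e v) with hf
  have hc : e.trans f ∈ atlas (ModelProd EB EG) (ConjBundle EQ EB EG G Q) :=
    ⟨e, ⟨b, rfl⟩, f, chart_mem_atlas _ _, rfl⟩
  have hvc : v ∈ (e.trans f).source := by
    rw [OpenPartialHomeomorph.trans_source]
    exact ⟨hv, mem_chart_source (ModelProd EB EG) (e v)⟩
  have h1 := (contMDiffOn_of_mem_maximalAtlas (I := 𝓘(ℝ, EB).prod 𝓘(ℝ, EG)) (n := ∞)
    (IsManifold.subset_maximalAtlas hc)).contMDiffAt ((e.trans f).open_source.mem_nhds hvc)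
  have h2 := (contMDiffOn_chart_symm (I := 𝓘(ℝ, EB).prod 𝓘(ℝ, EG)) (n := ∞)
    (x := e v)).contMDiffAt (f.open_target.mem_nhds (f.map_source (mem_chart_source _ (e v))))
  refine (h2.comp v h1).congr_of_eventuallyEq ?_
  filter_upwards [(e.trans f).open_source.mem_nhds hvc] with y hy
  rw [OpenPartialHomeomorph.trans_source] at hy
  exact (f.left_inv hy.2).symm

theorem contMDiffAt_conjChart_symm (b : OrbitSpace G Q) {y : OrbitSpace G Q × G}
    (hy : y ∈ (localTrivAt EQ EB EG b).conjChart.target) :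
    ContMDiffAt (𝓘(ℝ, EB).prod 𝓘(ℝ, EG)) (𝓘(ℝ, EB).prod 𝓘(ℝ, EG)) ∞
      (localTrivAt EQ EB EG b).conjChart.symm y := by
  set e := (localTrivAt EQ EB EG b).conjChart
  set f := chartAt (ModelProd EB EG) y with hf
  have hc : e.trans f ∈ atlas (ModelProd EB EG) (ConjBundle EQ EB EG G Q) :=
    ⟨e, ⟨b, rfl⟩, f, chart_mem_atlas _ _, rfl⟩
  have hyf : y ∈ f.source := mem_chart_source _ y
  have hyc : f y ∈ (e.trans f).target := by
    rw [OpenPartialHomeomorph.trans_target]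
    refine ⟨f.map_source hyf, ?_⟩
    rw [mem_preimage, f.left_inv hyf]
    exact hy
  have h1 := (contMDiffOn_symm_of_mem_maximalAtlas (I := 𝓘(ℝ, EB).prod 𝓘(ℝ, EG)) (n := ∞)
    (IsManifold.subset_maximalAtlas hc)).contMDiffAt ((e.trans f).open_target.mem_nhds hyc)
  have h2 := (contMDiffOn_chart (I := 𝓘(ℝ, EB).prod 𝓘(ℝ, EG)) (n := ∞)
    (x := y)).contMDiffAt (f.open_source.mem_nhds hyf)
  refine (h1.comp y h2).congr_of_eventuallyEq ?_
  filter_upwards [f.open_source.mem_nhds hyf] with z hz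
  exact congrArg e.symm (f.left_inv hz).symm

variable (EQ EB EG G Q) in
theorem contMDiff_conjMk : ContMDiff (𝓘(ℝ, EQ).prod 𝓘(ℝ, EG)) (𝓘(ℝ, EB).prod 𝓘(ℝ, EG)) ∞
    (conjMk EQ EB EG : Q × G → ConjBundle EQ EB EG G Q) := by
  rintro ⟨q, w⟩
  set t : LocalTriv EQ EB EG G Q := localTrivAt EQ EB EG (orbitProj G q) with htdef
  have ht : orbitProj G q ∈ t.baseSet := mem_localTrivAt_baseSet EQ EB EG _
  have hq := (t.mem_source_iff q).2 ht
  have h1 : ContMDiffAt (𝓘(ℝ, EQ).prod 𝓘(ℝ, EG)) 𝓘(ℝ, EG) ∞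
      (fun p : Q × G => (t.toFun p.1).2) (q, w) :=
    contMDiff_snd.contMDiffAt.comp (q, w)
      ((t.contMDiffAt_toFun hq).comp (q, w) contMDiffAt_fst)
  have h2 : ContMDiffAt (𝓘(ℝ, EQ).prod 𝓘(ℝ, EG)) (𝓘(ℝ, EB).prod 𝓘(ℝ, EG)) ∞ t.conjFun (q, w) :=
    (((contMDiff_orbitProj EQ EB G Q EG).contMDiffAt).comp (q, w) contMDiffAt_fst).prodMk
      ((h1.inv.mul contMDiffAt_snd).mul h1)
  have h3 : ContMDiffAt (𝓘(ℝ, EB).prod 𝓘(ℝ, EG)) (𝓘(ℝ, EB).prod 𝓘(ℝ, EG)) ∞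
      t.conjChart.symm (t.conjFun (q, w)) :=
    contMDiffAt_conjChart_symm _ ⟨ht, trivial⟩
  refine (h3.comp (q, w) h2).congr_of_eventuallyEq ?_
  have ho : IsOpen (t.source ×ˢ (univ : Set G)) := t.open_source.prod isOpen_univ
  filter_upwards [ho.mem_nhds ⟨hq, trivial⟩] with p hp
  have h4 := (t.mem_source_iff p.1).1 hp.1
  have h5 := conjChart_conjMk (EQ := EQ) (EB := EB) (EG := EG) _ h4 p.2
  have h6 := t.conjChart.left_inv (mem_conjChart_source (EQ := EQ) (EB := EB) (EG := EG) _ h4 p.2)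
  rw [Function.comp_apply, ← h5]
  exact h6.symm

end PrincipalBundle

/-! ### The maps `Ψ̃` and `Υ` -/

section Upsilon

variable {EQ EB EG G Q : Type*}
  [NormedAddCommGroup EQ] [NormedSpace ℝ EQ]
  [NormedAddCommGroup EG] [NormedSpace ℝ EG]
  [TopologicalSpace G] [ChartedSpace EG G] [Group G]
  [TopologicalSpace Q] [ChartedSpace EQ Q] [MulAction G Q]

namespace AffineDiscreteConnection

theorem conn_smul_right (A : AffineDiscreteConnection EQ EG G Q) (g : G) (q₀ q₁ : Q) :
    A.conn (q₀, g • q₁) = g * A.conn (q₀, q₁) := by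
  simpa using A.conn_smul 1 g q₀ q₁

theorem psiTilde_eq (A : AffineDiscreteConnection EQ EG G Q) (q : Q) (w : G) (x : Q) :
    A.psiTilde (q, w, orbitProj G x) = (q, (w * (A.conn (q, x))⁻¹) • x) := by
  obtain ⟨g, hg⟩ := exists_smul_of_orbitProj_eq (G := G) (q := (orbitProj G x).out) (q' := x)
    (Quotient.out_eq _)
  unfold psiTilde
  generalize (orbitProj G x).out = y at hg
  subst hg
  simp [conn_smul_right, ← mul_smul, mul_assoc]

theorem psiTilde_apply (A : AffineDiscreteConnection EQ EG G Q) (q₀ q₁ : Q) :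
    A.psiTilde (q₀, A.conn (q₀, q₁), orbitProj G q₁) = (q₀, q₁) := by
  simp [psiTilde_eq]

theorem upsilon_psiTilde (A : AffineDiscreteConnection EQ EG G Q) (q : Q) (w : G)
    (τ : OrbitSpace G Q) :
    A.upsilon EB (A.psiTilde (q, w, τ)) = (conjMk EQ EB EG (q, w), τ) := by
  obtain ⟨x, rfl⟩ : ∃ x, orbitProj G x = τ := Quotient.exists_rep τ
  simp [psiTilde_eq, upsilon, conn_smul_right, orbitProj_smul]

end AffineDiscreteConnection

theorem reducedLagrangian_upsilon [IsManifold 𝓘(ℝ, EQ) ∞ Q] (EB : Type*) (S : FDMS EQ Q)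
    (hS : S.IsSymmetric G) (A : AffineDiscreteConnection EQ EG G Q) (p : Q × Q) :
    reducedLagrangian EB S hS A (A.upsilon EB p) = S.lagrangian p :=
  congrArg S.lagrangian (A.psiTilde_apply p.1 p.2)

variable [NormedAddCommGroup EB] [NormedSpace ℝ EB] [ChartedSpace EB (OrbitSpace G Q)]
  [LieGroup 𝓘(ℝ, EG) ∞ G]

namespace AffineDiscreteConnection

variable (EB) in
theorem contMDiff_psiTilde [IsPrincipalBundle EQ EB EG G Q]
    (A : AffineDiscreteConnection EQ EG G Q) :
    ContMDiff (𝓘(ℝ, EQ).prod (𝓘(ℝ, EG).prod 𝓘(ℝ, EB))) (𝓘(ℝ, EQ).prod 𝓘(ℝ, EQ)) ∞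
      A.psiTilde := by
  rintro ⟨q, w, τ⟩
  obtain ⟨t, ht⟩ := IsPrincipalBundle.exists_localTriv (EQ := EQ) (EB := EB) (EG := EG) τ
  have hw : ContMDiffAt (𝓘(ℝ, EQ).prod (𝓘(ℝ, EG).prod 𝓘(ℝ, EB))) 𝓘(ℝ, EG) ∞
      (fun p : Q × G × OrbitSpace G Q => p.2.1) (q, w, τ) :=
    (contMDiff_fst.comp contMDiff_snd).contMDiffAt
  have hτ : ContMDiffAt (𝓘(ℝ, EQ).prod (𝓘(ℝ, EG).prod 𝓘(ℝ, EB))) 𝓘(ℝ, EB) ∞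
      (fun p : Q × G × OrbitSpace G Q => p.2.2) (q, w, τ) :=
    (contMDiff_snd.comp contMDiff_snd).contMDiffAt
  have hs := (t.contMDiffAt_section ht 1).comp (q, w, τ) hτ
  have hA := (A.contMDiff_conn.contMDiffAt).comp (q, w, τ) (contMDiffAt_fst.prodMk hs)
  have h : ContMDiffAt (𝓘(ℝ, EQ).prod (𝓘(ℝ, EG).prod 𝓘(ℝ, EB))) (𝓘(ℝ, EQ).prod 𝓘(ℝ, EQ)) ∞
      (fun p : Q × G × OrbitSpace G Q =>
        (p.1, (p.2.1 * (A.conn (p.1, t.invFun (p.2.2, 1)))⁻¹) • t.invFun (p.2.2, 1))) (q, w, τ) :=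
    contMDiffAt_fst.prodMk ((contMDiff_action EQ EG G Q EB).contMDiffAt.comp (q, w, τ)
      ((hw.mul hA.inv).prodMk hs))
  refine h.congr_of_eventuallyEq ?_
  filter_upwards [hτ.continuousAt (t.open_baseSet.mem_nhds ht)] with p hp
  obtain ⟨q', w', τ'⟩ := p
  have h1 := (t.symm_mem hp 1).2.1
  have h2 := A.psiTilde_eq q' w' (t.invFun (τ', 1))
  rw [h1] at h2
  exact h2

variable (EB) in
theorem contMDiff_upsilon [IsManifold 𝓘(ℝ, EB) ∞ (OrbitSpace G Q)] [IsPrincipalBundle EQ EB EG G Q]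
    (A : AffineDiscreteConnection EQ EG G Q) :
    ContMDiff (𝓘(ℝ, EQ).prod 𝓘(ℝ, EQ)) ((𝓘(ℝ, EB).prod 𝓘(ℝ, EG)).prod 𝓘(ℝ, EB)) ∞
      (A.upsilon EB) :=
  ((contMDiff_conjMk EQ EB EG G Q).comp (contMDiff_fst.prodMk A.contMDiff_conn)).prodMk
    ((contMDiff_orbitProj EQ EB G Q EG).comp contMDiff_snd)

variable [IsManifold 𝓘(ℝ, EB) ∞ (OrbitSpace G Q)] [IsPrincipalBundle EQ EB EG G Q]

variable (EB) in
/-- The map `Υ` is a principal bundle for the diagonal action: a local trivialization of `Q` over a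
neighborhood of `π q₀` gives a local section of `Υ`, obtained from `Ψ̃`, and the point of `Q × Q`
is recovered from its image by an element of `G` depending smoothly on it. -/
theorem exists_local_section (A : AffineDiscreteConnection EQ EG G Q) (p : Q × Q) :
    ∃ (σ : ConjBundle EQ EB EG G Q × OrbitSpace G Q → Q × Q) (κ : Q × Q → G),
      ContMDiffAt ((𝓘(ℝ, EB).prod 𝓘(ℝ, EG)).prod 𝓘(ℝ, EB)) (𝓘(ℝ, EQ).prod 𝓘(ℝ, EQ)) ∞ σ
        (A.upsilon EB p) ∧
      ContMDiffAt (𝓘(ℝ, EQ).prod 𝓘(ℝ, EQ)) 𝓘(ℝ, EG) ∞ κ p ∧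
      κ p = 1 ∧ (∀ᶠ z in 𝓝 (A.upsilon EB p), A.upsilon EB (σ z) = z) ∧
      ∀ᶠ y in 𝓝 p, κ y • σ (A.upsilon EB y) = y := by
  obtain ⟨a, b⟩ := p
  set t : LocalTriv EQ EB EG G Q := localTrivAt EQ EB EG (orbitProj G a) with htdef
  have ht : orbitProj G a ∈ t.baseSet := mem_localTrivAt_baseSet EQ EB EG _
  have hq := (t.mem_source_iff a).2 ht
  set c : G := (t.toFun a).2 with hc
  have hv := mem_conjChart_source (EQ := EQ) (EB := EB) (EG := EG) _ ht (A.conn (a, b))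
  have hchart := contMDiffAt_conjChart (EQ := EQ) (EB := EB) (EG := EG) _ hv
  have hval := conjChart_conjMk (EQ := EQ) (EB := EB) (EG := EG) _ ht (A.conn (a, b))
  rw [← htdef] at hv hchart hval
  -- The chart of `(q₀, w)` has second component `(c q₀)⁻¹ w (c q₀)`, the value of `w` after moving
  -- `q₀` to the slice `c = 1`. Conjugation by the value `c` at `a` moves it to the slice
  -- through `a`.
  refine ⟨fun z => A.psiTilde (t.invFun ((t.conjChart z.1).1, c),
    c * (t.conjChart z.1).2 * c⁻¹, z.2), fun y => (t.toFun y.1).2 * c⁻¹, ?_, ?_, ?_, ?_, ?_⟩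
  · have h1 : ContMDiffAt ((𝓘(ℝ, EB).prod 𝓘(ℝ, EG)).prod 𝓘(ℝ, EB)) (𝓘(ℝ, EB).prod 𝓘(ℝ, EG)) ∞
        (fun z : ConjBundle EQ EB EG G Q × OrbitSpace G Q => t.conjChart z.1)
        (A.upsilon EB (a, b)) :=
      ContMDiffAt.comp (A.upsilon EB (a, b)) hchart contMDiffAt_fst
    have h2 := contMDiffAt_fst.comp (A.upsilon EB (a, b)) h1
    have h3 := contMDiffAt_snd.comp (A.upsilon EB (a, b)) h1
    have hb : (t.conjChart (A.upsilon EB (a, b)).1).1 ∈ t.baseSet := by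
      rw [show t.conjChart (A.upsilon EB (a, b)).1 = t.conjFun (a, A.conn (a, b)) from hval]
      exact ht
    exact ((A.contMDiff_psiTilde EB).contMDiffAt).comp (A.upsilon EB (a, b))
      (((t.contMDiffAt_section hb c).comp (A.upsilon EB (a, b)) h2).prodMk
        (((contMDiffAt_const.mul h3).mul contMDiffAt_const).prodMk contMDiffAt_snd))
  · exact (contMDiffAt_snd.comp (a, b)
      ((t.contMDiffAt_toFun hq).comp (a, b) contMDiffAt_fst)).mul contMDiffAt_const
  · exact mul_inv_cancel c
  · have ho : IsOpen (t.conjChart.source ×ˢ (univ : Set (OrbitSpace G Q))) :=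
      t.conjChart.open_source.prod isOpen_univ
    filter_upwards [ho.mem_nhds ⟨hv, trivial⟩] with z hz
    obtain ⟨⟨⟨q, w⟩, ⟨hq', -⟩, h2⟩, -⟩ := hz
    obtain ⟨v, τ⟩ := z
    subst h2
    have hb := (t.mem_source_iff q).1 hq'
    have h3 : t.conjChart (conjMk EQ EB EG (q, w)) = t.conjFun (q, w) := t.conjFun_out hq' w
    simp only [h3, LocalTriv.conjFun, upsilon_psiTilde]
    refine Prod.ext ?_ rfl
    simp only
    rw [← conjMk_smul EQ EB EG ((t.toFun q).2 * c⁻¹), t.smul_invFun hb, inv_mul_cancel_right,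
      t.invFun_orbitProj hq']
    congr 2
    group
  · have ho : IsOpen (t.source ×ˢ (univ : Set Q)) := t.open_source.prod isOpen_univ
    filter_upwards [ho.mem_nhds ⟨hq, trivial⟩] with y hy
    obtain ⟨q₀, q₁⟩ := y
    have hq' : q₀ ∈ t.source := hy.1
    have hb := (t.mem_source_iff q₀).1 hq'
    have h3 : t.conjChart (conjMk EQ EB EG (q₀, A.conn (q₀, q₁))) =
      t.conjFun (q₀, A.conn (q₀, q₁)) := t.conjFun_out hq' _
    simp only [upsilon, h3, LocalTriv.conjFun]
    rw [← A.psiTilde_conj, t.smul_invFun hb, inv_mul_cancel_right, t.invFun_orbitProj hq']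
    refine Eq.trans ?_ (A.psiTilde_apply q₀ q₁)
    congr 3
    group

variable (EB) in
theorem isInvertible_upsilon_prod (A : AffineDiscreteConnection EQ EG G Q) (p : Q × Q)
    (θ : EQ × EQ →L[ℝ] EG)
    (hθ : ∀ ξ, θ (modelDeriv 𝓘(ℝ, EG) (𝓘(ℝ, EQ).prod 𝓘(ℝ, EQ)) (fun g : G => g • p) 1 ξ) = ξ) :
    ((modelDeriv (𝓘(ℝ, EQ).prod 𝓘(ℝ, EQ)) ((𝓘(ℝ, EB).prod 𝓘(ℝ, EG)).prod 𝓘(ℝ, EB))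
      (A.upsilon EB) p).prod θ).IsInvertible := by
  obtain ⟨σ, κ, hσ, hκ, hκp, h1, h2⟩ := A.exists_local_section EB p
  have h3 : σ (A.upsilon EB p) = p := by
    have h := h2.self_of_nhds
    rwa [hκp, one_smul] at h
  exact isInvertible_prod_of_local_section (contMDiff_diagAction EQ EG G Q EB)
    (fun g y => A.upsilon_smul g y) ((A.contMDiff_upsilon EB).mdifferentiable (by simp) p)
    (hκ.mdifferentiableAt (by simp)) hκp (hσ.mdifferentiableAt (by simp)) h3 h1 h2 θ hθ

end AffineDiscreteConnection

/-- The reduced Lagrangian is locally the composition of the Lagrangian with a section of `Υ`. -/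
theorem mdifferentiableAt_reducedLagrangian [IsManifold 𝓘(ℝ, EQ) ∞ Q]
    [IsManifold 𝓘(ℝ, EB) ∞ (OrbitSpace G Q)] [IsPrincipalBundle EQ EB EG G Q] (S : FDMS EQ Q)
    (hS : S.IsSymmetric G) (A : AffineDiscreteConnection EQ EG G Q) (p : Q × Q) :
    MDifferentiableAt ((𝓘(ℝ, EB).prod 𝓘(ℝ, EG)).prod 𝓘(ℝ, EB)) 𝓘(ℝ, ℝ)
      (reducedLagrangian EB S hS A) (A.upsilon EB p) := by
  obtain ⟨σ, κ, hσ, -, -, h1, -⟩ := A.exists_local_section EB p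
  have h := (S.contMDiff_lagrangian.contMDiffAt.comp (A.upsilon EB p) hσ).mdifferentiableAt
    (by simp)
  refine h.congr_of_eventuallyEq ?_
  filter_upwards [h1] with z hz
  rw [Function.comp_apply, ← reducedLagrangian_upsilon EB S hS A, hz]

end Upsilon

/-! ### Infinitesimal generators and horizontal lifts -/

section Generators

variable {EQ EB EG G Q : Type*}
  [NormedAddCommGroup EQ] [NormedSpace ℝ EQ]
  [NormedAddCommGroup EB] [NormedSpace ℝ EB]
  [NormedAddCommGroup EG] [NormedSpace ℝ EG]
  [TopologicalSpace G] [ChartedSpace EG G] [Group G]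
  [TopologicalSpace Q] [ChartedSpace EQ Q] [MulAction G Q]

theorem infGen_eq_modelDeriv (q : Q) (ξ : GroupLieAlgebra 𝓘(ℝ, EG) G) :
    (infGen q ξ : EQ) = modelDeriv 𝓘(ℝ, EG) 𝓘(ℝ, EQ) (fun g : G => g • q) 1 ξ :=
  castT_coe (one_smul G q) _

theorem rightTranslation_eq_modelDeriv (w : G) (ξ : GroupLieAlgebra 𝓘(ℝ, EG) G) :
    (rightTranslation w ξ : EG) = modelDeriv 𝓘(ℝ, EG) 𝓘(ℝ, EG) (fun h : G => h * w) 1 ξ :=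
  castT_coe (one_mul w) _

theorem PrincipalConnection.diag_apply [IsManifold 𝓘(ℝ, EQ) ∞ Q]
    (P : PrincipalConnection EQ EG G Q) (p : Q × Q) (u : EQ × EQ) :
    P.diag p u = (1 / 2 : ℝ) • (P.form p.1 u.1 + P.form p.2 u.2) := rfl

variable [ChartedSpace EB (OrbitSpace G Q)]

theorem modelDeriv_diag_orbit (EB : Type*) [NormedAddCommGroup EB] [NormedSpace ℝ EB]
    [ChartedSpace EB (OrbitSpace G Q)] [IsPrincipalBundle EQ EB EG G Q] (p : Q × Q)
    (ξ : GroupLieAlgebra 𝓘(ℝ, EG) G) :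
    modelDeriv 𝓘(ℝ, EG) (𝓘(ℝ, EQ).prod 𝓘(ℝ, EQ)) (fun g : G => g • p) 1 ξ =
      ((infGen p.1 ξ, infGen p.2 ξ) : EQ × EQ) := by
  have h := modelDeriv_prodMk
    (mdifferentiable_smul_point (contMDiff_action EQ EG G Q EB) p.1 1)
    (mdifferentiable_smul_point (contMDiff_action EQ EG G Q EB) p.2 1)
  refine (congrArg (fun l => l ξ) h).trans ?_
  exact Prod.ext (infGen_eq_modelDeriv p.1 ξ).symm (infGen_eq_modelDeriv p.2 ξ).symm

theorem modelDeriv_diag_smul (EB EG : Type*) [NormedAddCommGroup EB] [NormedSpace ℝ EB]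
    [NormedAddCommGroup EG] [NormedSpace ℝ EG] [ChartedSpace EG G]
    [ChartedSpace EB (OrbitSpace G Q)] [IsPrincipalBundle EQ EB EG G Q] (g : G) (p : Q × Q)
    (u : EQ × EQ) :
    modelDeriv (𝓘(ℝ, EQ).prod 𝓘(ℝ, EQ)) (𝓘(ℝ, EQ).prod 𝓘(ℝ, EQ)) (fun y : Q × Q => g • y) p u =
      (modelDeriv 𝓘(ℝ, EQ) 𝓘(ℝ, EQ) (fun x : Q => g • x) p.1 u.1,
        modelDeriv 𝓘(ℝ, EQ) 𝓘(ℝ, EQ) (fun x : Q => g • x) p.2 u.2) := by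
  have hg := mdifferentiable_smul_left (contMDiff_action EQ EG G Q EB) g
  have h1 := modelDeriv_comp (f := fun y : Q × Q => y.1) (x := p) (hg p.1)
    (mdifferentiableAt_fst (I' := 𝓘(ℝ, EQ))) rfl
  have h2 := modelDeriv_comp (f := fun y : Q × Q => y.2) (x := p) (hg p.2)
    (mdifferentiableAt_snd (I := 𝓘(ℝ, EQ))) rfl
  have h := modelDeriv_prodMk (f := fun y : Q × Q => g • y.1) (g := fun y : Q × Q => g • y.2)
    (x := p) ((hg p.1).comp p (mdifferentiableAt_fst (I := 𝓘(ℝ, EQ)) (I' := 𝓘(ℝ, EQ))))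
    ((hg p.2).comp p (mdifferentiableAt_snd (I := 𝓘(ℝ, EQ)) (I' := 𝓘(ℝ, EQ))))
  rw [h1, h2, modelDeriv_fst, modelDeriv_snd] at h
  exact congrArg (fun l => l u) h

/-- The form `½ (pr₁^* 𝔄 + pr₂^* 𝔄)` reproduces the generators of the diagonal action. -/
theorem PrincipalConnection.diag_generator [IsManifold 𝓘(ℝ, EQ) ∞ Q] (EB : Type*)
    [NormedAddCommGroup EB] [NormedSpace ℝ EB]
    [ChartedSpace EB (OrbitSpace G Q)] [IsPrincipalBundle EQ EB EG G Q]
    (P : PrincipalConnection EQ EG G Q) (p : Q × Q) (ξ : GroupLieAlgebra 𝓘(ℝ, EG) G) :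
    P.diag p (modelDeriv 𝓘(ℝ, EG) (𝓘(ℝ, EQ).prod 𝓘(ℝ, EQ)) (fun g : G => g • p) 1 ξ) = ξ := by
  refine (congrArg (P.diag p) (modelDeriv_diag_orbit EB p ξ)).trans ?_
  rw [PrincipalConnection.diag_apply, P.form_infGen, P.form_infGen, ← two_smul ℝ ξ, smul_smul]
  norm_num

theorem PrincipalConnection.diag_smul [IsManifold 𝓘(ℝ, EQ) ∞ Q] (EB : Type*)
    [NormedAddCommGroup EB] [NormedSpace ℝ EB]
    [ChartedSpace EB (OrbitSpace G Q)] [IsPrincipalBundle EQ EB EG G Q]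
    (P : PrincipalConnection EQ EG G Q) (g : G) (p : Q × Q) (u : EQ × EQ) :
    P.diag (g • p) (modelDeriv (𝓘(ℝ, EQ).prod 𝓘(ℝ, EQ)) (𝓘(ℝ, EQ).prod 𝓘(ℝ, EQ))
      (fun y : Q × Q => g • y) p u) = adjointMap g (P.diag p u) := by
  refine (congrArg (P.diag (g • p)) (modelDeriv_diag_smul EB EG g p u)).trans ?_
  rw [PrincipalConnection.diag_apply P p, map_smul, map_add]
  exact congrArg₂ (fun a b : EG => (1 / 2 : ℝ) • (a + b)) (P.form_smul g p.1 u.1)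
    (P.form_smul g p.2 u.2)

theorem modelDeriv_orbitProj_infGen [IsPrincipalBundle EQ EB EG G Q] (q : Q)
    (ξ : GroupLieAlgebra 𝓘(ℝ, EG) G) :
    modelDeriv 𝓘(ℝ, EQ) 𝓘(ℝ, EB) (orbitProj G) q (infGen q ξ) = 0 := by
  have h := modelDeriv_invariant_orbit (I := 𝓘(ℝ, EQ)) (contMDiff_action EQ EG G Q EB)
    orbitProj_smul ((contMDiff_orbitProj EQ EB G Q EG).mdifferentiable (by simp) q) ξ
  rwa [← infGen_eq_modelDeriv] at h

theorem modelDeriv_upsilon_smul [LieGroup 𝓘(ℝ, EG) ∞ G] [IsManifold 𝓘(ℝ, EB) ∞ (OrbitSpace G Q)]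
    [IsPrincipalBundle EQ EB EG G Q] (A : AffineDiscreteConnection EQ EG G Q) (g : G) (p : Q × Q)
    (u : EQ × EQ) :
    modelDeriv (𝓘(ℝ, EQ).prod 𝓘(ℝ, EQ)) ((𝓘(ℝ, EB).prod 𝓘(ℝ, EG)).prod 𝓘(ℝ, EB))
        (A.upsilon EB) (g • p) (modelDeriv (𝓘(ℝ, EQ).prod 𝓘(ℝ, EQ)) (𝓘(ℝ, EQ).prod 𝓘(ℝ, EQ))
          (fun y : Q × Q => g • y) p u) =
      modelDeriv (𝓘(ℝ, EQ).prod 𝓘(ℝ, EQ)) ((𝓘(ℝ, EB).prod 𝓘(ℝ, EG)).prod 𝓘(ℝ, EB))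
        (A.upsilon EB) p u := by
  have h := modelDeriv_comp (x := p) ((A.contMDiff_upsilon EB).mdifferentiable (by simp) (g • p))
    (mdifferentiable_smul_left (contMDiff_diagAction EQ EG G Q EB) g p) rfl
  simp only [A.upsilon_smul] at h
  exact (congrArg (fun l => l u) h).symm

variable [LieGroup 𝓘(ℝ, EG) ∞ G] [IsManifold 𝓘(ℝ, EQ) ∞ Q] [IsPrincipalBundle EQ EB EG G Q]

namespace PrincipalConnection

theorem isInvertible_orbitProj_prod_form (EB : Type*) [NormedAddCommGroup EB] [NormedSpace ℝ EB]
    [ChartedSpace EB (OrbitSpace G Q)] [IsPrincipalBundle EQ EB EG G Q]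
    (P : PrincipalConnection EQ EG G Q) (q : Q) :
    ((mfderiv 𝓘(ℝ, EQ) 𝓘(ℝ, EB) (orbitProj G) q).prod (P.form q)).IsInvertible :=
  isInvertible_orbitProj_prod (EQ := EQ) (EG := EG) EB q (P.form q) fun ξ =>
    (congrArg (P.form q) (infGen_eq_modelDeriv (EQ := EQ) (EG := EG) q ξ).symm).trans
      (P.form_infGen q ξ)

theorem prod_horLift (P : PrincipalConnection EQ EG G Q) (q : Q)
    (u : TangentSpace 𝓘(ℝ, EB) (orbitProj G q)) :
    (mfderiv 𝓘(ℝ, EQ) 𝓘(ℝ, EB) (orbitProj G) q).prod (P.form q) (P.horLift q u) = (u, 0) :=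
  (P.isInvertible_orbitProj_prod_form EB q).self_apply_inverse (u, 0)

theorem modelDeriv_horLift (P : PrincipalConnection EQ EG G Q) (q : Q)
    (u : TangentSpace 𝓘(ℝ, EB) (orbitProj G q)) :
    modelDeriv 𝓘(ℝ, EQ) 𝓘(ℝ, EB) (orbitProj G) q (P.horLift q u) = u :=
  congrArg Prod.fst (P.prod_horLift q u)

theorem form_horLift (P : PrincipalConnection EQ EG G Q) (q : Q)
    (u : TangentSpace 𝓘(ℝ, EB) (orbitProj G q)) : P.form q (P.horLift q u) = 0 :=
  congrArg Prod.snd (P.prod_horLift q u)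

/-- The decomposition of a tangent vector into its horizontal and vertical parts. -/
theorem horLift_add_infGen (EB : Type*) [NormedAddCommGroup EB] [NormedSpace ℝ EB]
    [ChartedSpace EB (OrbitSpace G Q)] [IsPrincipalBundle EQ EB EG G Q]
    (P : PrincipalConnection EQ EG G Q) (q : Q)
    (v : TangentSpace 𝓘(ℝ, EQ) q) :
    P.horLift q (mfderiv 𝓘(ℝ, EQ) 𝓘(ℝ, EB) (orbitProj G) q v) + infGen q (P.form q v) = v := by
  apply (P.isInvertible_orbitProj_prod_form EB q).injective
  rw [map_add, P.prod_horLift (EB := EB)]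
  refine Prod.ext ?_ ?_
  · have h := modelDeriv_orbitProj_infGen (EQ := EQ) (EB := EB) q (P.form q v)
    exact (congrArg (fun w : EB => modelDeriv 𝓘(ℝ, EQ) 𝓘(ℝ, EB) (orbitProj G) q v + w) h).trans
      (add_zero _)
  · exact (congrArg (fun w : EG => 0 + w) (P.form_infGen q (P.form q v))).trans (zero_add _)

end PrincipalConnection

/-! ### The reduced force -/

variable [IsManifold 𝓘(ℝ, EB) ∞ (OrbitSpace G Q)]

theorem isInvertible_splitting (A : AffineDiscreteConnection EQ EG G Q)
    (P : PrincipalConnection EQ EG G Q) (p : Q × Q) : (splitting EB A P p).IsInvertible :=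
  A.isInvertible_upsilon_prod EB p (P.diag p) (P.diag_generator EB p)

/-- The value of the reduced force does not depend on the representative of the class in the
adjoint bundle used in its definition. -/
theorem reducedForce_apply (S : FDMS EQ Q) (hS : S.IsSymmetric G)
    (A : AffineDiscreteConnection EQ EG G Q) (P : PrincipalConnection EQ EG G Q) (p : Q × Q)
    (u : EQ × EQ) :
    reducedForce S A P (A.upsilon EB p)
      (modelDeriv (𝓘(ℝ, EQ).prod 𝓘(ℝ, EQ)) ((𝓘(ℝ, EB).prod 𝓘(ℝ, EG)).prod 𝓘(ℝ, EB))
        (A.upsilon EB) p u) ⟨adjointMk p (P.diag p u), rfl⟩ = S.force.toFun p u := by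
  have key : ∀ (r : (Q × Q) × GroupLieAlgebra 𝓘(ℝ, EG) G)
      (hr : A.upsilon EB p = A.upsilon EB r.1),
      (∃ g : G, g • p = r.1 ∧ adjointMap g (P.diag p u) = r.2) →
      S.force.toFun r.1 ((splitting EB A P r.1).inverse (castT hr
        (modelDeriv (𝓘(ℝ, EQ).prod 𝓘(ℝ, EQ)) ((𝓘(ℝ, EB).prod 𝓘(ℝ, EG)).prod 𝓘(ℝ, EB))
        (A.upsilon EB) p u), r.2)) = S.force.toFun p u := by
    rintro ⟨p', ξ⟩ hr ⟨g, h1, h2⟩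
    simp only at h1 h2 hr
    subst h1 h2
    refine Eq.trans ?_ (hS.force_smul g p u)
    refine congrArg (S.force.toFun (g • p)) ?_
    refine (isInvertible_splitting A P (g • p)).inverse_apply_eq.2 ?_
    refine Prod.ext ?_ ?_
    · refine (castT_coe hr _).trans ?_
      exact (modelDeriv_upsilon_smul A g p u).symm
    · exact (P.diag_smul EB g p u).symm
  refine key _ _ ?_
  exact Quotient.exact (s := adjointSetoid EG G Q)
    (Quotient.out_eq (s := adjointSetoid EG G Q) (adjointMk p (P.diag p u))).symm

end Generators

/-! ### The unreduced equations -/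

section Unreduced

/-- Summation by parts for variations with fixed end points. -/
theorem sum_eq_sum_interior {E : Type*} [NormedAddCommGroup E] [NormedSpace ℝ E] {M : ℕ}
    (F : Fin (M + 1) → E × E →L[ℝ] ℝ) (δ : Fin (M + 2) → E) (h0 : δ 0 = 0)
    (hl : δ (Fin.last (M + 1)) = 0) :
    ∑ k, F k (δ k.castSucc, δ k.succ) =
      ∑ i : Fin M, (F i.castSucc (0, δ i.succ.castSucc) + F i.succ (δ i.succ.castSucc, 0)) := by
  have h : ∀ k, F k (δ k.castSucc, δ k.succ) = F k (0, δ k.succ) + F k (δ k.castSucc, 0) := by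
    intro k
    rw [← map_add]
    simp
  have hz : ((0 : E), (0 : E)) = 0 := rfl
  simp only [h, Finset.sum_add_distrib]
  rw [Fin.sum_univ_castSucc (fun k => F k (0, δ k.succ)),
    Fin.sum_univ_succ (fun k => F k (δ k.castSucc, 0)), Fin.succ_last, hl, Fin.castSucc_zero, h0,
    hz, map_zero, map_zero, add_zero, zero_add]
  simp only [Fin.succ_castSucc]

variable {EQ Q : Type*} [NormedAddCommGroup EQ] [NormedSpace ℝ EQ]
  [TopologicalSpace Q] [ChartedSpace EQ Q] [IsManifold 𝓘(ℝ, EQ) ∞ Q]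

namespace FDMS

/-- The covector `dL_d + f_d` on `Q × Q`. -/
def forcedDifferential (S : FDMS EQ Q) (p : Q × Q) : EQ × EQ →L[ℝ] ℝ :=
  let f : EQ × EQ →L[ℝ] ℝ := S.force.toFun p
  modelDeriv (𝓘(ℝ, EQ).prod 𝓘(ℝ, EQ)) 𝓘(ℝ, ℝ) S.lagrangian p + f

theorem forcedDifferential_apply (S : FDMS EQ Q) (p : Q × Q) (w : EQ × EQ) :
    S.forcedDifferential p w =
      modelDeriv (𝓘(ℝ, EQ).prod 𝓘(ℝ, EQ)) 𝓘(ℝ, ℝ) S.lagrangian p w + S.force.toFun p w := rfl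

theorem mdifferentiable_lagrangian (S : FDMS EQ Q) :
    MDifferentiable (𝓘(ℝ, EQ).prod 𝓘(ℝ, EQ)) 𝓘(ℝ, ℝ) S.lagrangian :=
  S.contMDiff_lagrangian.mdifferentiable (by simp)

theorem eulerLagrange_apply (S : FDMS EQ Q) (a b c : Q) (v : EQ) :
    S.eulerLagrange a b c v =
      S.forcedDifferential (a, b) (0, v) + S.forcedDifferential (b, c) (v, 0) := by
  have h : S.eulerLagrange a b c v =
      modelDeriv (𝓘(ℝ, EQ).prod 𝓘(ℝ, EQ)) 𝓘(ℝ, ℝ) S.lagrangian (a, b) (0, v) +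
      modelDeriv (𝓘(ℝ, EQ).prod 𝓘(ℝ, EQ)) 𝓘(ℝ, ℝ) S.lagrangian (b, c) (v, 0) +
      S.force.toFun (a, b) ((0, v) : EQ × EQ) + S.force.toFun (b, c) ((v, 0) : EQ × EQ) := rfl
  rw [h, forcedDifferential_apply, forcedDifferential_apply]
  ring

theorem variation_eq (S : FDMS EQ Q) {N : ℕ} (q : Fin (N + 1) → Q)
    (δq : ∀ k, TangentSpace 𝓘(ℝ, EQ) (q k)) :
    differential (ModelWithCorners.pi fun _ : Fin (N + 1) => 𝓘(ℝ, EQ)) S.action q (familyT δq) +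
      ∑ k : Fin N, S.force.toFun (q k.castSucc, q k.succ)
        (pairT (δq k.castSucc) (δq k.succ)) =
    ∑ k : Fin N, S.forcedDifferential (q k.castSucc, q k.succ)
      ((δq k.castSucc, δq k.succ) : EQ × EQ) := by
  have h := differential_sum_comp S.lagrangian
    (fun (y : Fin (N + 1) → Q) (k : Fin N) => (y k.castSucc, y k.succ)) _ q
    (fun _ => S.mdifferentiable_lagrangian _)
    (fun k => (hasMFDerivAt_eval (I := 𝓘(ℝ, EQ)) q k.castSucc).prodMk
      (hasMFDerivAt_eval (I := 𝓘(ℝ, EQ)) q k.succ)) (δq : Fin (N + 1) → EQ)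
  refine (congrArg (fun x : ℝ => x + ∑ k : Fin N, S.force.toFun (q k.castSucc, q k.succ)
        (pairT (δq k.castSucc) (δq k.succ))) h).trans ?_
  exact (Finset.sum_add_distrib (M := ℝ)).symm

theorem forcedEulerLagrange_iff (S : FDMS EQ Q) {M : ℕ} (q : Fin (M + 2) → Q) :
    S.ForcedEulerLagrange q ↔ ∀ i : Fin M, S.eulerLagrange (q i.castSucc.castSucc)
      (q i.succ.castSucc) (q i.succ.succ) = 0 := by
  constructor
  · intro h i
    exact h (i + 1) (by omega) (by omega)
  · rintro h k h1 hk
    obtain ⟨i, rfl⟩ := Nat.exists_eq_add_of_le' h1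
    exact h ⟨i, by omega⟩

theorem isTrajectory_iff_forcedEulerLagrange (S : FDMS EQ Q) {N : ℕ} (q : Fin (N + 1) → Q) :
    S.IsTrajectory q ↔ S.ForcedEulerLagrange q := by
  unfold IsTrajectory
  simp only [variation_eq]
  obtain _ | M := N
  · exact ⟨fun _ k h1 hk => by omega, fun _ _ _ _ => by simp⟩
  rw [forcedEulerLagrange_iff]
  let el : Fin M → EQ →L[ℝ] ℝ := fun i =>
    S.eulerLagrange (q i.castSucc.castSucc) (q i.succ.castSucc) (q i.succ.succ)
  have key : ∀ δ : Fin (M + 2) → EQ, δ 0 = 0 → δ (Fin.last (M + 1)) = 0 →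
      ∑ k : Fin (M + 1), S.forcedDifferential (q k.castSucc, q k.succ)
        (δ k.castSucc, δ k.succ) =
      ∑ i : Fin M, el i (δ i.succ.castSucc) := by
    intro δ h0 hl
    rw [sum_eq_sum_interior (fun k => S.forcedDifferential (q k.castSucc, q k.succ)) δ h0 hl]
    exact Finset.sum_congr rfl fun i _ => (S.eulerLagrange_apply _ _ _ _).symm
  constructor
  · intro h i
    suffices hi : el i = 0 from hi
    ext v
    -- The variation that moves a single interior point isolates one equation.
    have h0 : (Pi.single i.succ.castSucc v : Fin (M + 2) → EQ) 0 = 0 := by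
      apply Pi.single_eq_of_ne
      simp [Fin.ext_iff]
    have hl : (Pi.single i.succ.castSucc v : Fin (M + 2) → EQ) (Fin.last (M + 1)) = 0 := by
      apply Pi.single_eq_of_ne
      have := i.2
      simp only [ne_eq, Fin.ext_iff, Fin.val_last, Fin.val_castSucc, Fin.val_succ]
      omega
    have h1 := (key _ h0 hl).symm.trans (h _ h0 hl)
    rw [Finset.sum_eq_single i] at h1
    · rw [Pi.single_eq_same] at h1
      exact h1
    · intro j _ hj
      rw [Pi.single_eq_of_ne (by simpa [Fin.ext_iff] using hj)]
      exact map_zero _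
    · simp
  · intro h δ h0 hl
    refine (key δ h0 hl).trans (Finset.sum_eq_zero fun i _ => ?_)
    rw [show el i = 0 from h i]
    rfl

end FDMS

end Unreduced

section Reduced

variable {EQ EB EG G Q : Type*}
  [NormedAddCommGroup EQ] [NormedSpace ℝ EQ]
  [NormedAddCommGroup EB] [NormedSpace ℝ EB]
  [NormedAddCommGroup EG] [NormedSpace ℝ EG]
  [TopologicalSpace G] [ChartedSpace EG G] [Group G] [LieGroup 𝓘(ℝ, EG) ∞ G]
  [TopologicalSpace Q] [ChartedSpace EQ Q] [MulAction G Q]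
  [ChartedSpace EB (OrbitSpace G Q)] [IsManifold 𝓘(ℝ, EB) ∞ (OrbitSpace G Q)]
  [IsPrincipalBundle EQ EB EG G Q]

/-! ### The reduced variational principle -/

theorem modelDeriv_upsilon (A : AffineDiscreteConnection EQ EG G Q) (q₀ q₁ : Q) (u₀ u₁ : EQ) :
    modelDeriv (𝓘(ℝ, EQ).prod 𝓘(ℝ, EQ)) ((𝓘(ℝ, EB).prod 𝓘(ℝ, EG)).prod 𝓘(ℝ, EB))
      (A.upsilon EB) (q₀, q₁) (u₀, u₁) =
    ((conjVariation EB A (q₀ := q₀) (q₁ := q₁) u₀ u₁ : EB × EG),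
      modelDeriv 𝓘(ℝ, EQ) 𝓘(ℝ, EB) (orbitProj G) q₁ u₁) := by
  have hA : MDifferentiableAt (𝓘(ℝ, EQ).prod 𝓘(ℝ, EQ)) 𝓘(ℝ, EG) (fun p => A.conn p) (q₀, q₁) :=
    A.contMDiff_conn.mdifferentiable (by simp) _
  have hρ := (contMDiff_conjMk EQ EB EG G Q).mdifferentiable (by simp) (q₀, A.conn (q₀, q₁))
  have hπ := (contMDiff_orbitProj EQ EB G Q EG).mdifferentiable (by simp) q₁
  have hf : MDifferentiableAt (𝓘(ℝ, EQ).prod 𝓘(ℝ, EQ)) (𝓘(ℝ, EQ).prod 𝓘(ℝ, EG))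
      (fun p : Q × Q => (p.1, A.conn p)) (q₀, q₁) := mdifferentiableAt_fst.prodMk hA
  have h1 := modelDeriv_comp hρ hf rfl
  rw [modelDeriv_prodMk mdifferentiableAt_fst hA, modelDeriv_fst] at h1
  have h2 := modelDeriv_comp (x := (q₀, q₁)) (f := fun p : Q × Q => p.2) hπ
    (mdifferentiableAt_snd (I := 𝓘(ℝ, EQ))) rfl
  rw [modelDeriv_snd] at h2
  have h3 := modelDeriv_prodMk (hρ.comp (q₀, q₁) hf)
    (hπ.comp (q₀, q₁) (mdifferentiableAt_snd (I := 𝓘(ℝ, EQ))))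
  refine (congrArg (fun l => l (u₀, u₁)) h3).trans ?_
  exact Prod.ext (congrArg (fun l => l (u₀, u₁)) h1) (congrArg (fun l => l (u₀, u₁)) h2)

theorem conjVariation_add (A : AffineDiscreteConnection EQ EG G Q) {q₀ q₁ : Q} (u₀ v₀ u₁ v₁ : EQ) :
    (conjVariation EB A (q₀ := q₀) (q₁ := q₁) (u₀ + v₀) (u₁ + v₁) : EB × EG) =
      (conjVariation EB A (q₀ := q₀) (q₁ := q₁) u₀ u₁ : EB × EG) +
      (conjVariation EB A (q₀ := q₀) (q₁ := q₁) v₀ v₁ : EB × EG) := by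
  have h := map_add (modelDeriv (𝓘(ℝ, EQ).prod 𝓘(ℝ, EQ))
    ((𝓘(ℝ, EB).prod 𝓘(ℝ, EG)).prod 𝓘(ℝ, EB)) (A.upsilon EB) (q₀, q₁)) (u₀, u₁) (v₀, v₁)
  rw [Prod.mk_add_mk, modelDeriv_upsilon, modelDeriv_upsilon, modelDeriv_upsilon] at h
  exact congrArg Prod.fst h

variable [IsManifold 𝓘(ℝ, EQ) ∞ Q]

theorem modelDeriv_reducedLagrangian (S : FDMS EQ Q) (hS : S.IsSymmetric G)
    (A : AffineDiscreteConnection EQ EG G Q) (p : Q × Q) (u : EQ × EQ) :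
    modelDeriv ((𝓘(ℝ, EB).prod 𝓘(ℝ, EG)).prod 𝓘(ℝ, EB)) 𝓘(ℝ, ℝ) (reducedLagrangian EB S hS A)
      (A.upsilon EB p) (modelDeriv (𝓘(ℝ, EQ).prod 𝓘(ℝ, EQ))
        ((𝓘(ℝ, EB).prod 𝓘(ℝ, EG)).prod 𝓘(ℝ, EB)) (A.upsilon EB) p u) =
    modelDeriv (𝓘(ℝ, EQ).prod 𝓘(ℝ, EQ)) 𝓘(ℝ, ℝ) S.lagrangian p u := by
  have h := modelDeriv_comp (mdifferentiableAt_reducedLagrangian (EB := EB) S hS A p)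
    ((A.contMDiff_upsilon EB).mdifferentiable (by simp) p) rfl
  simp only [reducedLagrangian_upsilon] at h
  exact (congrArg (fun l => l u) h).symm

/-- One term of the reduced variational principle. Here `δ` and `ζ` are the two components of the
image of `u` under `splitting`; they are variables so that other expressions for them can be
used. -/
theorem reduced_term_eq (S : FDMS EQ Q) (hS : S.IsSymmetric G)
    (A : AffineDiscreteConnection EQ EG G Q) (P : PrincipalConnection EQ EG G Q) (p : Q × Q)
    (u : EQ × EQ) (δ : (EB × EG) × EB)
    (hδ : modelDeriv (𝓘(ℝ, EQ).prod 𝓘(ℝ, EQ)) ((𝓘(ℝ, EB).prod 𝓘(ℝ, EG)).prod 𝓘(ℝ, EB))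
      (A.upsilon EB) p u = δ)
    (ζ : GroupLieAlgebra 𝓘(ℝ, EG) G) (hζ : P.diag p u = ζ) :
    modelDeriv ((𝓘(ℝ, EB).prod 𝓘(ℝ, EG)).prod 𝓘(ℝ, EB)) 𝓘(ℝ, ℝ) (reducedLagrangian EB S hS A)
      (A.upsilon EB p) δ +
      reducedForce S A P (A.upsilon EB p) δ ⟨adjointMk p ζ, rfl⟩ = S.forcedDifferential p u := by
  subst hδ hζ
  rw [modelDeriv_reducedLagrangian, reducedForce_apply S hS]
  rfl

/-- The constrained variation of the reduced curve is the image under `TΥ` of the variation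
`u_k = h^{q_k} δτ_k + (ξ_k)_Q (q_k)` of the curve. -/
theorem reduced_variation_eq (S : FDMS EQ Q) (hS : S.IsSymmetric G)
    (A : AffineDiscreteConnection EQ EG G Q) (P : PrincipalConnection EQ EG G Q) {N : ℕ}
    (q : Fin (N + 1) → Q) (δτ : ∀ k, TangentSpace 𝓘(ℝ, EB) (orbitProj G (q k)))
    (ξ : Fin (N + 1) → GroupLieAlgebra 𝓘(ℝ, EG) G)
    (δv : ∀ k : Fin N, TangentSpace (𝓘(ℝ, EB).prod 𝓘(ℝ, EG)) (reducedCurve EB A q k).1)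
    (hδv : ∀ k : Fin N, δv k =
      conjVariation EB A (P.horLift (q k.castSucc) (δτ k.castSucc))
        (P.horLift (q k.succ) (δτ k.succ)) +
      conjVariation EB A (infGen (q k.castSucc) (ξ k.castSucc))
        (infGen (q k.succ) (ξ k.succ)))
    (u : Fin (N + 1) → EQ) (hu : ∀ k, u k = P.horLift (q k) (δτ k) + infGen (q k) (ξ k)) :
    differential (ModelWithCorners.pi fun _ : Fin N => (𝓘(ℝ, EB).prod 𝓘(ℝ, EG)).prod 𝓘(ℝ, EB))
        (reducedAction S hS A) (reducedCurve EB A q)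
        (familyT fun k => pairT (δv k) (δτ k.succ)) +
      ∑ k : Fin N, reducedForce S A P (reducedCurve EB A q k) (pairT (δv k) (δτ k.succ))
        ⟨adjointMk (q k.castSucc, q k.succ) ((1 / 2 : ℝ) • (ξ k.castSucc + ξ k.succ)), rfl⟩ =
    ∑ k : Fin N, S.forcedDifferential (q k.castSucc, q k.succ) (u k.castSucc, u k.succ) := by
  have h := differential_sum_comp (reducedLagrangian EB S hS A)
    (fun (z : Fin N → ConjBundle EQ EB EG G Q × OrbitSpace G Q) (k : Fin N) => z k) _
    (reducedCurve EB A q)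
    (fun k => mdifferentiableAt_reducedLagrangian S hS A (q k.castSucc, q k.succ))
    (fun k => hasMFDerivAt_eval (I := (𝓘(ℝ, EB).prod 𝓘(ℝ, EG)).prod 𝓘(ℝ, EB)) _ k)
    (fun k => ((δv k, δτ k.succ) : (EB × EG) × EB))
  refine (congrArg (fun x : ℝ => x + ∑ k : Fin N, reducedForce S A P (reducedCurve EB A q k)
    (pairT (δv k) (δτ k.succ)) ⟨adjointMk (q k.castSucc, q k.succ)
      ((1 / 2 : ℝ) • (ξ k.castSucc + ξ k.succ)), rfl⟩) h).trans ?_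
  refine (Finset.sum_add_distrib (M := ℝ)).symm.trans (Finset.sum_congr rfl fun k _ => ?_)
  have hform : ∀ k, P.form (q k) (u k) = ξ k := by
    intro k
    refine ((congrArg (P.form (q k)) (hu k)).trans (map_add (P.form (q k)) _ _)).trans ?_
    rw [P.form_horLift, P.form_infGen, zero_add]
  refine reduced_term_eq S hS A P (q k.castSucc, q k.succ) (u k.castSucc, u k.succ) _ ?_ _ ?_
  · refine (modelDeriv_upsilon A _ _ _ _).trans (Prod.ext ?_ ?_)
    · rw [hu, hu]
      exact (conjVariation_add A _ _ _ _).trans (hδv k).symm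
    · have h1 := map_add (modelDeriv 𝓘(ℝ, EQ) 𝓘(ℝ, EB) (orbitProj G) (q k.succ))
        (P.horLift (q k.succ) (δτ k.succ)) (infGen (q k.succ) (ξ k.succ))
      have h2 := P.modelDeriv_horLift (q k.succ) (δτ k.succ)
      have h3 := modelDeriv_orbitProj_infGen (EQ := EQ) (EB := EB) (q k.succ) (ξ k.succ)
      exact (congrArg (modelDeriv 𝓘(ℝ, EQ) 𝓘(ℝ, EB) (orbitProj G) (q k.succ)) (hu k.succ)).trans
        (h1.trans ((congrArg₂ (fun a b : EB => a + b) h2 h3).trans (add_zero _)))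
  · rw [PrincipalConnection.diag_apply]
    exact congrArg₂ (fun a b : EG => (1 / 2 : ℝ) • (a + b)) (hform _) (hform _)

theorem reducedVariationalPrinciple_iff_isTrajectory (S : FDMS EQ Q) (hS : S.IsSymmetric G)
    (A : AffineDiscreteConnection EQ EG G Q) (P : PrincipalConnection EQ EG G Q) {N : ℕ}
    (q : Fin (N + 1) → Q) :
    ReducedVariationalPrinciple EB S hS A P q ↔ S.IsTrajectory q := by
  unfold FDMS.IsTrajectory
  simp only [FDMS.variation_eq]
  constructor
  · intro h δq h0 hl
    have h1 := h (fun k => mfderiv 𝓘(ℝ, EQ) 𝓘(ℝ, EB) (orbitProj G) (q k) (δq k))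
      (fun k => P.form (q k) (δq k)) _ (fun k => rfl) (by simp only [h0, map_zero])
      (by simp only [hl, map_zero]) (by simp only [h0, map_zero]) (by simp only [hl, map_zero])
    refine Eq.trans ?_ h1
    exact (reduced_variation_eq S hS A P q _ _ _ (fun k => rfl) (δq : Fin (N + 1) → EQ)
      fun k => (P.horLift_add_infGen EB (q k) (δq k)).symm).symm
  · intro h δτ ξ δv hδv h0 hl h0' hl'
    refine (reduced_variation_eq S hS A P q δτ ξ δv hδv _ fun k => rfl).trans ?_
    refine h (fun k => P.horLift (q k) (δτ k) + infGen (q k) (ξ k)) ?_ ?_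
    · simp only [h0, h0', map_zero, add_zero]
    · simp only [hl, hl', map_zero, add_zero]

end Reduced

section ReducedEquations

variable {EQ EB EG G Q : Type*}
  [NormedAddCommGroup EQ] [NormedSpace ℝ EQ]
  [NormedAddCommGroup EB] [NormedSpace ℝ EB]
  [NormedAddCommGroup EG] [NormedSpace ℝ EG]
  [TopologicalSpace G] [ChartedSpace EG G] [Group G]
  [TopologicalSpace Q] [ChartedSpace EQ Q] [MulAction G Q]
  [ChartedSpace EB (OrbitSpace G Q)]

/-! ### The explicit reduced equations -/

theorem covec_apply {q : Q} {w : G} {τ : OrbitSpace G Q}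
    (α : TangentSpace (𝓘(ℝ, EQ).prod (𝓘(ℝ, EG).prod 𝓘(ℝ, EB))) (q, w, τ) →L[ℝ] ℝ)
    (u : EQ) (x : EG) (y : EB) :
    α ((u, x, y) : EQ × EG × EB) = covec₁ α u + covec₂ α x + covec₃ α y := by
  let β : EQ × EG × EB →L[ℝ] ℝ := α
  change β (u, x, y) = β (u, 0) + β (0, x, 0) + β (0, 0, y)
  rw [← map_add, ← map_add]
  simp

/-- Moving the second point along its orbit multiplies the discrete connection on the left. -/
theorem AffineDiscreteConnection.D₂_infGen (EB : Type*) [NormedAddCommGroup EB] [NormedSpace ℝ EB]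
    [ChartedSpace EB (OrbitSpace G Q)] [IsPrincipalBundle EQ EB EG G Q]
    (A : AffineDiscreteConnection EQ EG G Q) (q₀ q₁ : Q) (ξ : GroupLieAlgebra 𝓘(ℝ, EG) G) :
    A.D₂ q₀ q₁ (infGen q₁ ξ) = rightTranslation (A.conn (q₀, q₁)) ξ := by
  have hg := mdifferentiable_smul_point (contMDiff_action EQ EG G Q EB) q₁ 1
  have hA : MDifferentiableAt (𝓘(ℝ, EQ).prod 𝓘(ℝ, EQ)) 𝓘(ℝ, EG) A.conn (q₀, q₁) :=
    A.contMDiff_conn.mdifferentiable (by simp) _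
  have h := modelDeriv_comp (f := fun g : G => (q₀, g • q₁)) hA
    (mdifferentiableAt_const.prodMk hg) (by rw [one_smul])
  rw [modelDeriv_prodMk mdifferentiableAt_const hg, modelDeriv_const] at h
  simp only [A.conn_smul_right] at h
  have h1 := congrArg (fun l => l ξ) h
  refine Eq.trans ?_ (h1.symm.trans (rightTranslation_eq_modelDeriv _ ξ).symm)
  exact congrArg (fun v : EQ => modelDeriv (𝓘(ℝ, EQ).prod 𝓘(ℝ, EQ)) 𝓘(ℝ, EG) A.conn (q₀, q₁)
    ((0, v) : EQ × EQ)) (infGen_eq_modelDeriv q₁ ξ)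

/-- The differential of an invariant Lagrangian vanishes on the generators of the diagonal
action. -/
theorem FDMS.IsSymmetric.modelDeriv_lagrangian_infGen [IsManifold 𝓘(ℝ, EQ) ∞ Q]
    (EB : Type*) [NormedAddCommGroup EB] [NormedSpace ℝ EB]
    [ChartedSpace EB (OrbitSpace G Q)] [IsPrincipalBundle EQ EB EG G Q]
    {S : FDMS EQ Q} (hS : S.IsSymmetric G) (p : Q × Q) (ξ : GroupLieAlgebra 𝓘(ℝ, EG) G) :
    modelDeriv (𝓘(ℝ, EQ).prod 𝓘(ℝ, EQ)) 𝓘(ℝ, ℝ) S.lagrangian p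
      ((infGen p.1 ξ, infGen p.2 ξ) : EQ × EQ) = 0 := by
  rw [← modelDeriv_diag_orbit EB p ξ]
  exact modelDeriv_invariant_orbit (contMDiff_diagAction EQ EG G Q EB) hS.lagrangian_smul
    (S.mdifferentiable_lagrangian p) ξ

theorem AffineDiscreteConnection.modelDeriv_conn (A : AffineDiscreteConnection EQ EG G Q)
    (q₀ q₁ : Q) (u v : EQ) :
    modelDeriv (𝓘(ℝ, EQ).prod 𝓘(ℝ, EQ)) 𝓘(ℝ, EG) A.conn (q₀, q₁) (u, v) =
      (A.D₁ q₀ q₁ u : EG) + (A.D₂ q₀ q₁ v : EG) := by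
  have h := map_add (modelDeriv (𝓘(ℝ, EQ).prod 𝓘(ℝ, EQ)) 𝓘(ℝ, EG) A.conn (q₀, q₁)) (u, 0) (0, v)
  rw [Prod.mk_add_mk, add_zero, zero_add] at h
  exact h

/-- The derivative of `(q₀, q₁) ↦ (q₀, A_d (q₀, q₁), π q₁)` at `(u, v)`, written with the partial
derivatives of `A_d`. -/
def psiDeriv (EB : Type*) [NormedAddCommGroup EB] [NormedSpace ℝ EB]
    [ChartedSpace EB (OrbitSpace G Q)] (A : AffineDiscreteConnection EQ EG G Q) (q₀ q₁ : Q)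
    (u v : EQ) : EQ × EG × EB :=
  (u, (A.D₁ q₀ q₁ u : EG) + (A.D₂ q₀ q₁ v : EG), modelDeriv 𝓘(ℝ, EQ) 𝓘(ℝ, EB) (orbitProj G) q₁ v)

section

variable (A : AffineDiscreteConnection EQ EG G Q) {q₀ q₁ : Q}
  (α : TangentSpace (𝓘(ℝ, EQ).prod (𝓘(ℝ, EG).prod 𝓘(ℝ, EB)))
    (q₀, A.conn (q₀, q₁), orbitProj G q₁) →L[ℝ] ℝ)

theorem covec_psiDeriv (u v : EQ) :
    α (psiDeriv EB A q₀ q₁ u v) =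
      covec₁ α u + (covec₂ α (A.D₁ q₀ q₁ u) + covec₂ α (A.D₂ q₀ q₁ v)) +
        covec₃ α (modelDeriv 𝓘(ℝ, EQ) 𝓘(ℝ, EB) (orbitProj G) q₁ v) :=
  (covec_apply α _ _ _).trans (congrArg (fun x : ℝ => covec₁ α u + x +
    covec₃ α (modelDeriv 𝓘(ℝ, EQ) 𝓘(ℝ, EB) (orbitProj G) q₁ v))
    (map_add (covec₂ α) (A.D₁ q₀ q₁ u) (A.D₂ q₀ q₁ v)))

theorem covec_psiDeriv_left (u : EQ) :
    α (psiDeriv EB A q₀ q₁ u 0) = covec₁ α u + covec₂ α (A.D₁ q₀ q₁ u) := by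
  have h := covec_psiDeriv A α u 0
  have h2 : covec₂ α (A.D₂ q₀ q₁ (0 : EQ)) = 0 := map_zero ((covec₂ α).comp (A.D₂ q₀ q₁))
  have h3 : covec₃ α (modelDeriv 𝓘(ℝ, EQ) 𝓘(ℝ, EB) (orbitProj G) q₁ (0 : EQ)) = 0 :=
    (congrArg (covec₃ α) (map_zero (modelDeriv 𝓘(ℝ, EQ) 𝓘(ℝ, EB) (orbitProj G) q₁))).trans
      (map_zero (covec₃ α))
  linarith

theorem covec_psiDeriv_right (v : EQ) :
    α (psiDeriv EB A q₀ q₁ 0 v) = covec₂ α (A.D₂ q₀ q₁ v) +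
      covec₃ α (modelDeriv 𝓘(ℝ, EQ) 𝓘(ℝ, EB) (orbitProj G) q₁ v) := by
  have h := covec_psiDeriv A α 0 v
  have h1 : covec₁ α (0 : EQ) = 0 := map_zero (covec₁ α)
  have h2 : covec₂ α (A.D₁ q₀ q₁ (0 : EQ)) = 0 := map_zero ((covec₂ α).comp (A.D₁ q₀ q₁))
  linarith

end

variable [LieGroup 𝓘(ℝ, EG) ∞ G] [IsPrincipalBundle EQ EB EG G Q]

/-- The map `Ψ̃` is a left inverse of `(q₀, q₁) ↦ (q₀, A_d (q₀, q₁), π q₁)`, so its derivative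
undoes `psiDeriv`. -/
theorem modelDeriv_psiTilde (A : AffineDiscreteConnection EQ EG G Q) (q₀ q₁ : Q) (u v : EQ) :
    modelDeriv (𝓘(ℝ, EQ).prod (𝓘(ℝ, EG).prod 𝓘(ℝ, EB))) (𝓘(ℝ, EQ).prod 𝓘(ℝ, EQ)) A.psiTilde
      (q₀, A.conn (q₀, q₁), orbitProj G q₁) (psiDeriv EB A q₀ q₁ u v) = (u, v) := by
  have hA : MDifferentiableAt (𝓘(ℝ, EQ).prod 𝓘(ℝ, EQ)) 𝓘(ℝ, EG) (fun p => A.conn p) (q₀, q₁) :=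
    A.contMDiff_conn.mdifferentiable (by simp) _
  have hπ := (contMDiff_orbitProj EQ EB G Q EG).mdifferentiable (by simp) q₁
  have hπ' : MDifferentiableAt (𝓘(ℝ, EQ).prod 𝓘(ℝ, EQ)) 𝓘(ℝ, EB)
      (fun p : Q × Q => orbitProj G p.2) (q₀, q₁) :=
    hπ.comp (q₀, q₁) (mdifferentiableAt_snd (I := 𝓘(ℝ, EQ)))
  have h1 := modelDeriv_comp (x := (q₀, q₁)) (f := fun p : Q × Q => p.2) hπ
    (mdifferentiableAt_snd (I := 𝓘(ℝ, EQ))) rfl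
  rw [modelDeriv_snd] at h1
  have hf : MDifferentiableAt (𝓘(ℝ, EQ).prod 𝓘(ℝ, EQ)) (𝓘(ℝ, EQ).prod (𝓘(ℝ, EG).prod 𝓘(ℝ, EB)))
      (fun p : Q × Q => (p.1, A.conn p, orbitProj G p.2)) (q₀, q₁) :=
    mdifferentiableAt_fst.prodMk (hA.prodMk hπ')
  have h2 := modelDeriv_comp ((A.contMDiff_psiTilde EB).mdifferentiable (by simp)
    (q₀, A.conn (q₀, q₁), orbitProj G q₁)) hf rfl
  rw [modelDeriv_prodMk mdifferentiableAt_fst (hA.prodMk hπ'), modelDeriv_fst] at h2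
  have h3 := modelDeriv_prodMk hA hπ'
  have h4 : (fun p : Q × Q => A.psiTilde (p.1, A.conn p, orbitProj G p.2)) = fun p => p :=
    funext fun p => A.psiTilde_apply p.1 p.2
  rw [h4, modelDeriv_id] at h2
  refine Eq.trans ?_ (congrArg (fun l => l (u, v)) h2).symm
  refine congrArg (modelDeriv (𝓘(ℝ, EQ).prod (𝓘(ℝ, EG).prod 𝓘(ℝ, EB))) (𝓘(ℝ, EQ).prod 𝓘(ℝ, EQ))
    A.psiTilde (q₀, A.conn (q₀, q₁), orbitProj G q₁)) (Prod.ext rfl ?_)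
  refine Eq.trans ?_ (congrArg (fun l => l (u, v)) h3).symm
  exact Prod.ext (A.modelDeriv_conn q₀ q₁ u v).symm (congrArg (fun l => l (u, v)) h1).symm

variable [IsManifold 𝓘(ℝ, EQ) ∞ Q]

theorem dCheckLagrangian_psiDeriv (S : FDMS EQ Q) (A : AffineDiscreteConnection EQ EG G Q)
    (q₀ q₁ : Q) (u v : EQ) :
    dCheckLagrangian EB S A q₀ q₁ (psiDeriv EB A q₀ q₁ u v) =
      modelDeriv (𝓘(ℝ, EQ).prod 𝓘(ℝ, EQ)) 𝓘(ℝ, ℝ) S.lagrangian (q₀, q₁) (u, v) := by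
  have h := modelDeriv_comp (S.mdifferentiable_lagrangian (q₀, q₁))
    ((A.contMDiff_psiTilde EB).mdifferentiable (by simp) (q₀, A.conn (q₀, q₁), orbitProj G q₁))
    (A.psiTilde_apply q₀ q₁)
  refine (congrArg (fun l => l (psiDeriv EB A q₀ q₁ u v)) h).trans ?_
  rw [ContinuousLinearMap.comp_apply, modelDeriv_psiTilde]

theorem checkForceAt_psiDeriv (S : FDMS EQ Q) (A : AffineDiscreteConnection EQ EG G Q)
    (q₀ q₁ : Q) (u v : EQ) :
    checkForceAt EB S A q₀ q₁ (psiDeriv EB A q₀ q₁ u v) =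
      S.force.toFun (q₀, q₁) ((u, v) : EQ × EQ) := by
  have h : ∀ p p' : Q × Q, p = p' → ∀ w w' : EQ × EQ, w = w' →
      S.force.toFun p w = S.force.toFun p' w' := by
    rintro p _ rfl w _ rfl
    rfl
  exact h _ _ (A.psiTilde_apply q₀ q₁) _ _ (modelDeriv_psiTilde A q₀ q₁ u v)

/-- The chain rule for `L_d = Ľ_d ∘ Ψ` and `f_d = Ψ^* f̌_d`, where `Ψ` is the inverse of `Ψ̃`. The
right-hand side is the formula for `φ` with `v` in place of a horizontal lift. -/
theorem eulerLagrange_eq_covec (EB : Type*) [NormedAddCommGroup EB]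
    [NormedSpace ℝ EB] [ChartedSpace EB (OrbitSpace G Q)] [IsPrincipalBundle EQ EB EG G Q]
    (S : FDMS EQ Q) (A : AffineDiscreteConnection EQ EG G Q) (a b c : Q) (v : EQ) :
    S.eulerLagrange a b c v =
      covec₁ (dCheckLagrangian EB S A b c) v +
      covec₃ (dCheckLagrangian EB S A a b) (modelDeriv 𝓘(ℝ, EQ) 𝓘(ℝ, EB) (orbitProj G) b v) +
      covec₂ (dCheckLagrangian EB S A b c) (A.D₁ b c v) +
      covec₂ (dCheckLagrangian EB S A a b) (A.D₂ a b v) +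
      covec₁ (checkForceAt EB S A b c) v +
      covec₃ (checkForceAt EB S A a b) (modelDeriv 𝓘(ℝ, EQ) 𝓘(ℝ, EB) (orbitProj G) b v) +
      covec₂ (checkForceAt EB S A b c) (A.D₁ b c v) +
      covec₂ (checkForceAt EB S A a b) (A.D₂ a b v) := by
  rw [S.eulerLagrange_apply, S.forcedDifferential_apply, S.forcedDifferential_apply,
    ← dCheckLagrangian_psiDeriv (EB := EB) S A, ← dCheckLagrangian_psiDeriv (EB := EB) S A,
    ← checkForceAt_psiDeriv (EB := EB) S A, ← checkForceAt_psiDeriv (EB := EB) S A]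
  have h1 := covec_psiDeriv_right A (dCheckLagrangian EB S A a b) v
  have h2 := covec_psiDeriv_left A (dCheckLagrangian EB S A b c) v
  have h3 := covec_psiDeriv_right A (checkForceAt EB S A a b) v
  have h4 := covec_psiDeriv_left A (checkForceAt EB S A b c) v
  linarith

theorem eulerLagrange_horLift (S : FDMS EQ Q) (A : AffineDiscreteConnection EQ EG G Q)
    (P : PrincipalConnection EQ EG G Q) (a b c : Q) (u : TangentSpace 𝓘(ℝ, EB) (orbitProj G b)) :
    S.eulerLagrange a b c (P.horLift b u) = phi EB S A P a b c u := by
  refine (eulerLagrange_eq_covec EB S A a b c (P.horLift b u)).trans ?_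
  rw [P.modelDeriv_horLift]
  rfl

theorem eulerLagrange_infGen (EB : Type*) [NormedAddCommGroup EB]
    [NormedSpace ℝ EB] [ChartedSpace EB (OrbitSpace G Q)] [IsPrincipalBundle EQ EB EG G Q]
    (S : FDMS EQ Q) (hS : S.IsSymmetric G) (A : AffineDiscreteConnection EQ EG G Q)
    (a b c : Q) (ξ : GroupLieAlgebra 𝓘(ℝ, EG) G) :
    S.eulerLagrange a b c (infGen b ξ) = psi EB S A a b c ξ := by
  have h1 := eulerLagrange_eq_covec EB S A a b c (infGen b ξ)
  have h2 := covec_psiDeriv A (dCheckLagrangian EB S A b c) (infGen b ξ) (infGen c ξ)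
  -- By invariance, the terms at `(b, c)` reduce to the one with `D₂ A_d (b, c)`, up to sign.
  have hL : dCheckLagrangian EB S A b c (psiDeriv EB A b c (infGen b ξ) (infGen c ξ)) = 0 :=
    (dCheckLagrangian_psiDeriv S A b c _ _).trans (hS.modelDeriv_lagrangian_infGen EB (b, c) ξ)
  have hπ : ∀ (q₀ q₁ : Q) (α : TangentSpace (𝓘(ℝ, EQ).prod (𝓘(ℝ, EG).prod 𝓘(ℝ, EB)))
      (q₀, A.conn (q₀, q₁), orbitProj G q₁) →L[ℝ] ℝ),
      covec₃ α (modelDeriv 𝓘(ℝ, EQ) 𝓘(ℝ, EB) (orbitProj G) q₁ (infGen q₁ ξ)) = 0 :=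
    fun q₀ q₁ α => (congrArg (covec₃ α) (modelDeriv_orbitProj_infGen (EQ := EQ)
      (EB := EB) q₁ ξ)).trans
      (map_zero (covec₃ α))
  have hD := congrArg (covec₂ (dCheckLagrangian EB S A a b)) (A.D₂_infGen EB a b ξ)
  have hD' := congrArg (covec₂ (dCheckLagrangian EB S A b c)) (A.D₂_infGen EB b c ξ)
  have hπ₁ := hπ a b (dCheckLagrangian EB S A a b)
  have hπ₂ := hπ a b (checkForceAt EB S A a b)
  have hπ₃ := hπ b c (dCheckLagrangian EB S A b c)
  have hψ : psi EB S A a b c ξ =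
      covec₂ (dCheckLagrangian EB S A a b) (rightTranslation (A.conn (a, b)) ξ) -
      covec₂ (dCheckLagrangian EB S A b c) (rightTranslation (A.conn (b, c)) ξ) +
      (covec₁ (checkForceAt EB S A b c) (infGen b ξ) +
        covec₂ (checkForceAt EB S A b c) (A.D₁ b c (infGen b ξ)) +
        covec₂ (checkForceAt EB S A a b) (A.D₂ a b (infGen b ξ))) := rfl
  linarith

theorem eulerLagrange_eq_zero_iff (S : FDMS EQ Q) (hS : S.IsSymmetric G)
    (A : AffineDiscreteConnection EQ EG G Q) (P : PrincipalConnection EQ EG G Q) (a b c : Q) :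
    S.eulerLagrange a b c = 0 ↔ phi EB S A P a b c = 0 ∧ ∀ ξ : GroupLieAlgebra 𝓘(ℝ, EG) G,
      psi EB S A a b c ξ = 0 := by
  constructor
  · intro h
    refine ⟨?_, fun ξ => ?_⟩
    · ext u
      rw [← eulerLagrange_horLift, h]
      rfl
    · rw [← eulerLagrange_infGen EB S hS, h]
      rfl
  · rintro ⟨h1, h2⟩
    ext v
    rw [← P.horLift_add_infGen EB b v, map_add, eulerLagrange_horLift,
      eulerLagrange_infGen EB S hS, h1, h2]
    simp

theorem forcedEulerLagrange_iff_reducedEquations (S : FDMS EQ Q) (hS : S.IsSymmetric G)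
    (A : AffineDiscreteConnection EQ EG G Q) (P : PrincipalConnection EQ EG G Q) {N : ℕ}
    (q : Fin (N + 1) → Q) : S.ForcedEulerLagrange q ↔ ReducedEquations EB S A P q :=
  forall_congr' fun _ => forall_congr' fun _ => forall_congr' fun _ =>
    eulerLagrange_eq_zero_iff S hS A P _ _ _

end ReducedEquations

end ForcedReduction

end

theorem mainTheorem1 {EQ EB EG G Q : Type*}
    [NormedAddCommGroup EQ] [NormedSpace ℝ EQ] [FiniteDimensional ℝ EQ]
    [NormedAddCommGroup EB] [NormedSpace ℝ EB] [FiniteDimensional ℝ EB]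
    [NormedAddCommGroup EG] [NormedSpace ℝ EG] [FiniteDimensional ℝ EG]
    [TopologicalSpace G] [ChartedSpace EG G] [Group G] [LieGroup 𝓘(ℝ, EG) ∞ G]
    [TopologicalSpace Q] [ChartedSpace EQ Q] [IsManifold 𝓘(ℝ, EQ) ∞ Q] [MulAction G Q]
    [ChartedSpace EB (OrbitSpace G Q)] [IsManifold 𝓘(ℝ, EB) ∞ (OrbitSpace G Q)]
    [IsPrincipalBundle EQ EB EG G Q]
    (A : AffineDiscreteConnection EQ EG G Q) (P : PrincipalConnection EQ EG G Q)
    (S : FDMS EQ Q) (hS : S.IsSymmetric G) (N : ℕ) (q : Fin (N + 1) → Q) :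
    List.TFAE [
      S.IsTrajectory q,
      S.ForcedEulerLagrange q,
      ReducedVariationalPrinciple EB S hS A P q,
      ReducedEquations EB S A P q] := by
  tfae_have 1 ↔ 2 := S.isTrajectory_iff_forcedEulerLagrange q
  tfae_have 3 ↔ 1 := reducedVariationalPrinciple_iff_isTrajectory S hS A P q
  tfae_have 2 ↔ 4 := forcedEulerLagrange_iff_reducedEquations S hS A P q
  tfae_finish
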